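/- Let $G$ be a locally compact (Hausdorff) unimodular group and $H\le G$ a compact subgroup with normalized Haar measure $\omega_H$, regarded as a measure on $G$. Let $X:=G/H$ and $D:=G//H=\{HgH: g\in G\}$ carry the quotient topologies and their Borel $\sigma$-algebras. (a) $X$ and $D$ are locally compact Hausdorff spaces, and the canonical projections $p_G:G\to X$, $x\mapsto xH$, and $p_{G/H}:X\to D$, $xH\mapsto HxH$, are continuous, open and closed. (b) $K((xH,HhH),A):=p_G(\delta_x*\omega_H*\delta_h*\omega_H)(A)$ ($x,h\in G$, $A\in\mathcal B(X)$) is a well-defined Markov kernel from $X\times D$ to $X$, where $*$ is the convolution of bounded regular Borel measures on $G$ and $p_G(\mu)$ is the push forward of $\mu$. (c) Suppose in addition that $X$ is second countable. Then $(X,D,K)$ is a unimodular continuous association scheme (CAS) that is strong, and its hypergroup is the double coset hypergroup $(G//H,*)$: identity $HeH$, involution $HgH\mapsto Hg^{-1}H$, and $p(\mu)*p(\nu)=p(\mu*\nu)$ for all bounded regular Borel measures $\mu,\nu$ on $G$ with $\mu=\omega_H*\mu*\omega_H$ and $\nu=\omega_H*\nu*\omega_H$, where $p:G\to G//H$ is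 the projection. Definitions used in (c). A *hypergroup* $(D,*)$ is a locally compact Hausdorff space $D$ with an associative, bilinear, weakly continuous convolution $*$ on the space $M_b(D)$ of bounded complex regular Borel measures (weakly continuous: it preserves positivity and is jointly weakly continuous on positive measures) such that $\delta_x*\delta_y$ is a probability measure with compact support, depending continuously on $(x,y)$ in the Michael (Vietoris) topology; there is $e\in D$ with $\delta_x*\delta_e=\delta_e*\delta_x=\delta_x$; and there is a continuous involution $x\mapsto\bar x$ with $e\in\operatorname{supp}(\delta_x*\delta_y)\iff y=\bar x$ and $(\delta_x*\delta_y)^-=\delta_{\bar y}*\delta_{\bar x}$, where $\mu^-$ is the image of $\mu$ under the involution. A *left* (*right*) *Haar measure* is a non-zero Radon measure $\omega$ on $D$ with $\int_D\int_D f\,d(\delta_x*\delta_y)\,d\omega(y)=\int f\,d\omega$ (respectively with $\delta_y*\delta_x$) for all $f\in C_c(D)$, $x\in D$; the hypergroup is *unimodular* if some measure is both. For second countable locally compact Hausdorff spaces $X,D$ and a Markov kernel $K$ from $X\times D$ to $X$ put $K_h(x,A):=K((x,h),A)$ and $T_hf(x):=\int_X f(y)\,K_h(x,dy)$. Then $(X,D,K)$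 is a *CAS* if: (0) $(x,h)\mapsto T_hf(x)$ is continuous for every bounded continuous $f$ on $X$; (1) $\operatorname{supp}K_h(x,\cdot)$ is compact and depends continuously on $(x,h)$ in the Hausdorff (equivalently Vietoris) topology; (2) for each $x\in X$ the sets $\operatorname{supp}K_h(x,\cdot)$ ($h\in D$) form a partition of $X$, and the map $\pi:X\times X\to D$ with $y\in\operatorname{supp}K_{\pi(x,y)}(x,\cdot)$ is continuous; (3) $D$ carries a hypergroup structure with $\int_X K_{h_2}(y,A)\,K_{h_1}(x,dy)=\int_D K_h(x,A)\,d(\delta_{h_1}*\delta_{h_2})(h)$ for all $h_1,h_2\in D$, $x\in X$, $A\in\mathcal B(X)$, and $K_e(x,\cdot)=\delta_x$; (4) there is a Radon measure $\omega_X$ on $X$ with full support such that $\int_X T_{\bar h}f\cdot g\,d\omega_X=\int_X f\cdot T_hg\,d\omega_X$ for all $h\in D$, $f,g\in C_c(X)$. A CAS is *unimodular* if its hypergroup is. It is *strong* if both of the following hold. (T1) For all $h\in D$, $x,y\in X$, $f\in C_c(D)$: $\int_D f\,d(\delta_{\pi(x,y)}*\delta_h)=\int_X f(\pi(x,z))\,K_h(y,dz)$.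 (T2) For some $\omega_X$ as in (4) and some left Haar measure $\omega_D$ of $(D,*)$, for all $f\in C_c(D)$, $g\in C_c(X)$, $x\in X$: $\int_D T_hg(x)\,f(h)\,d\omega_D(h)=\int_X f(\pi(x,y))\,g(y)\,d\omega_X(y)$. -/

import Mathlib

open MeasureTheory TopologicalSpace ProbabilityTheory
open scoped BoundedContinuousFunction

noncomputable section

/-! ### Supports -/

/-- Every measure `κ p` has compact support, and `p ↦ supp (κ p)` is continuous as a map into the
compact subsets of `Y`. Mathlib's topology on `Compacts Y` is the Vietoris topology, which is the
Michael topology, and is the topology of the Hausdorff metric whenever `Y` is metrizable. -/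
def HasContinuousCompactSupport {E Y : Type*} [TopologicalSpace E] [TopologicalSpace Y]
    [MeasurableSpace Y] (κ : E → Measure Y) : Prop :=
  ∃ S : E → Compacts Y, Continuous S ∧ ∀ p, (S p : Set Y) = (κ p).support

/-! ### Hypergroups -/

/-- A finite positive measure, regarded as a complex measure. -/
def MeasureTheory.FiniteMeasure.toComplex {D : Type*} [MeasurableSpace D]
    (μ : FiniteMeasure D) : ComplexMeasure D :=
  (μ : Measure D).toSignedMeasure.toComplexMeasure 0

/-- The point mass `δ_x` as a finite measure. -/
def diracFM {D : Type*} [MeasurableSpace D] (x : D) : FiniteMeasure D :=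
  ⟨Measure.dirac x, inferInstance⟩

/-- A bilinear, associative, weakly continuous convolution of the bounded complex Borel measures
on a second countable, locally compact Hausdorff space `D`; on such a space every bounded Borel
measure is regular. As usual for hypergroups, weak continuity means that the convolution
preserves positivity and that its restriction `posConv` to positive measures is jointly
continuous for the weak topology given by the bounded continuous functions (which is the topology
of Mathlib's `FiniteMeasure D`). -/
structure MeasureConvolution (D : Type*) [TopologicalSpace D] [MeasurableSpace D]
    [BorelSpace D] where
  t2Space : T2Space D
  locallyCompactSpace : LocallyCompactSpace D
  secondCountable : SecondCountableTopology D
  conv : ComplexMeasure D →ₗ[ℂ] ComplexMeasure D →ₗ[ℂ] ComplexMeasure D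
  conv_assoc : ∀ μ ν ρ, conv (conv μ ν) ρ = conv μ (conv ν ρ)
  posConv : FiniteMeasure D → FiniteMeasure D → FiniteMeasure D
  conv_toComplex : ∀ μ ν : FiniteMeasure D,
    conv μ.toComplex ν.toComplex = (posConv μ ν).toComplex
  continuous_posConv : Continuous fun p : FiniteMeasure D × FiniteMeasure D => posConv p.1 p.2

/-- The measure `δ_x * δ_y`. -/
def MeasureConvolution.ptConv {D : Type*} [TopologicalSpace D] [MeasurableSpace D]
    [BorelSpace D] (c : MeasureConvolution D) (x y : D) : Measure D :=
  (c.posConv (diracFM x) (diracFM y) : FiniteMeasure D)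

/-- A (second countable) hypergroup structure on `D`. -/
structure Hypergroup (D : Type*) [TopologicalSpace D] [MeasurableSpace D] [BorelSpace D]
    extends MeasureConvolution D where
  isProbabilityMeasure_ptConv : ∀ x y, IsProbabilityMeasure (toMeasureConvolution.ptConv x y)
  support_ptConv :
    HasContinuousCompactSupport fun p : D × D => toMeasureConvolution.ptConv p.1 p.2
  e : D
  ptConv_e : ∀ x, toMeasureConvolution.ptConv x e = Measure.dirac x
  e_ptConv : ∀ x, toMeasureConvolution.ptConv e x = Measure.dirac x
  inv : D → D
  continuous_inv : Continuous inv
  inv_inv : ∀ x, inv (inv x) = x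
  e_mem_support_iff : ∀ x y, e ∈ (toMeasureConvolution.ptConv x y).support ↔ y = inv x
  map_inv_ptConv : ∀ x y, (toMeasureConvolution.ptConv x y).map inv =
    toMeasureConvolution.ptConv (inv y) (inv x)

namespace Hypergroup

variable {D : Type*} [TopologicalSpace D] [MeasurableSpace D] [BorelSpace D]

/-- `ω` is a left Haar measure: a non-zero Radon measure with
`∫ f(x * y) dω(y) = ∫ f dω` for all `f ∈ C_c(D)` and `x ∈ D`. -/
structure IsLeftHaar (𝓗 : Hypergroup D) (ω : Measure D) : Prop where
  regular : ω.Regular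
  ne_zero : ω ≠ 0
  invariant : ∀ (f : D → ℂ), Continuous f → HasCompactSupport f → ∀ x : D,
    ∫ y, (∫ z, f z ∂(𝓗.ptConv x y)) ∂ω = ∫ y, f y ∂ω

/-- `ω` is a right Haar measure: a non-zero Radon measure with
`∫ f(y * x) dω(y) = ∫ f dω` for all `f ∈ C_c(D)` and `x ∈ D`. -/
structure IsRightHaar (𝓗 : Hypergroup D) (ω : Measure D) : Prop where
  regular : ω.Regular
  ne_zero : ω ≠ 0
  invariant : ∀ (f : D → ℂ), Continuous f → HasCompactSupport f → ∀ x : D,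
    ∫ y, (∫ z, f z ∂(𝓗.ptConv y x)) ∂ω = ∫ y, f y ∂ω

/-- A hypergroup is unimodular if it has a measure that is a left and a right Haar measure. -/
def IsUnimodular (𝓗 : Hypergroup D) : Prop :=
  ∃ ω : Measure D, 𝓗.IsLeftHaar ω ∧ 𝓗.IsRightHaar ω

end Hypergroup

/-! ### Continuous association schemes -/

/-- `ω` is a Radon measure on `X` with full support, such that
`∫ (T_{h̄} f) g dω = ∫ f (T_h g) dω` for all `h ∈ D` and `f, g ∈ C_c(X)`, where
`T_h f (x) = ∫ f(y) K(x,h;dy)`. -/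
structure IsAdjointMeasure {X D : Type*} [TopologicalSpace X] [MeasurableSpace X]
    (K : X × D → Measure X) (inv : D → D) (ω : Measure X) : Prop where
  regular : ω.Regular
  support_eq : ω.support = Set.univ
  adjoint : ∀ (h : D) (f g : X → ℂ), Continuous f → HasCompactSupport f →
    Continuous g → HasCompactSupport g →
    ∫ x, (∫ y, f y ∂(K (x, inv h))) * g x ∂ω = ∫ x, f x * (∫ y, g y ∂(K (x, h))) ∂ω

/-- A continuous association scheme `(X, D, K)`. The product `X × D` carries the Borel
σ-algebra of the product topology. The hypergroup structure on `D` and the map `proj` (that is,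
`π : X × X → D`) are determined by `K`. -/
structure CAS (X D : Type*) [TopologicalSpace X] [MeasurableSpace X] [BorelSpace X]
    [TopologicalSpace D] [MeasurableSpace D] [BorelSpace D] where
  t2Space : T2Space X
  locallyCompactSpace : LocallyCompactSpace X
  secondCountable : SecondCountableTopology X
  K : Kernel[borel (X × D)] (X × D) X
  isMarkovKernel : IsMarkovKernel K
  continuous_K : ∀ f : X →ᵇ ℂ, Continuous fun p : X × D => ∫ y, f y ∂(K p)
  support_K : HasContinuousCompactSupport fun p : X × D => K p
  support_nonempty : ∀ x h, (K (x, h)).support.Nonempty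
  partition : ∀ x y : X, ∃! h : D, y ∈ (K (x, h)).support
  proj : X → X → D
  mem_support_proj : ∀ x y, y ∈ (K (x, proj x y)).support
  continuous_proj : Continuous fun p : X × X => proj p.1 p.2
  hyp : Hypergroup D
  comp_eq : ∀ (h₁ h₂ : D) (x : X) (A : Set X), MeasurableSet A →
    ∫⁻ y, K (y, h₂) A ∂(K (x, h₁)) = ∫⁻ h, K (x, h) A ∂(hyp.ptConv h₁ h₂)
  K_e : ∀ x, K (x, hyp.e) = Measure.dirac x
  exists_adjointMeasure : ∃ ω : Measure X, IsAdjointMeasure K hyp.inv ω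

namespace CAS

variable {X D : Type*} [TopologicalSpace X] [MeasurableSpace X] [BorelSpace X]
  [TopologicalSpace D] [MeasurableSpace D] [BorelSpace D]

/-- A continuous association scheme is unimodular if its hypergroup is. -/
def IsUnimodular (C : CAS X D) : Prop := C.hyp.IsUnimodular

/-- The translation property (T1): `f_h ∘ π_x = T_h (f ∘ π_x)` for `f ∈ C_c(D)`, where
`π_x = π(x, ·)` and `f_h(l) = ∫ f d(δ_l * δ_h)`. -/
def HasT1 (C : CAS X D) : Prop :=
  ∀ (h : D) (x : X) (f : D → ℂ), Continuous f → HasCompactSupport f → ∀ y : X,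
    ∫ l, f l ∂(C.hyp.ptConv (C.proj x y) h) = ∫ z, f (C.proj x z) ∂(C.K (y, h))

/-- The translation property (T2): for suitably normalized `ω_X` and left Haar measure `ω_D`, one
has `T_f = T^{f ∘ π}` for all `f ∈ C_c(D)`, where
`T_f g (x) = ∫_D ∫_X g(y) K_h(x,dy) f(h) dω_D(h)` and
`T^F g (x) = ∫_X F(x,y) g(y) dω_X(y)` for `g ∈ C_c(X)`. -/
def HasT2 (C : CAS X D) : Prop :=
  ∃ (ωX : Measure X) (ωD : Measure D), IsAdjointMeasure C.K C.hyp.inv ωX ∧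
    C.hyp.IsLeftHaar ωD ∧
    ∀ f : D → ℂ, Continuous f → HasCompactSupport f →
    ∀ g : X → ℂ, Continuous g → HasCompactSupport g → ∀ x : X,
      ∫ h, (∫ y, g y ∂(C.K (x, h))) * f h ∂ωD = ∫ y, f (C.proj x y) * g y ∂ωX

/-- A continuous association scheme is strong if it has (T1) and (T2). -/
def IsStrong (C : CAS X D) : Prop := C.HasT1 ∧ C.HasT2

end CAS

/-! ### Measures on groups, coset spaces and double coset spaces -/

section Group

variable {G : Type*} [Group G] [TopologicalSpace G] [IsTopologicalGroup G]

/-- The quotient topology on a double coset space. -/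
instance DoubleCoset.instTopologicalSpaceQuotient (S T : Set G) :
    TopologicalSpace (DoubleCoset.Quotient S T) :=
  inferInstanceAs (TopologicalSpace (_root_.Quotient (DoubleCoset.setoid S T)))

/-- The canonical map `G/H → G//H`, `xH ↦ HxH`. -/
def cosetToDoubleCoset (H : Subgroup G) :
    G ⧸ H → DoubleCoset.Quotient (H : Set G) (H : Set G) :=
  Quotient.lift (fun x : G => DoubleCoset.mk H H x) fun x y hxy =>
    (DoubleCoset.eq H H x y).2
      ⟨1, H.one_mem, x⁻¹ * y, QuotientGroup.leftRel_apply.1 hxy, by group⟩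

variable [MeasurableSpace G] [BorelSpace G]

/-- The convolution `(μ * ν)(A) = ∫ ν(x⁻¹ A) dμ(x)` of finite regular Borel measures on `G`.
In this form it is meaningful also when the Borel σ-algebra of `G × G` is larger than the product
σ-algebra, where `MeasureTheory.Measure.mconv` is not. -/
def groupConv (μ ν : Measure G) : Measure G := μ.bind fun x => ν.map fun y => x * y

/-- The normalized Haar measure `ω_H` of a compact subgroup `H`, as a measure on `G`. -/
def haarOfCompact (H : Subgroup G) [CompactSpace H] : Measure G :=
  (Measure.haarMeasure (⊤ : PositiveCompacts H)).map Subtype.val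

/-- The measure `p_G(δ_x * ω_H * δ_h * ω_H)` on `G/H`. -/
def cosetKernel (H : Subgroup G) [CompactSpace H] [MeasurableSpace (G ⧸ H)] (x h : G) :
    Measure (G ⧸ H) :=
  (groupConv (Measure.dirac x) (groupConv (haarOfCompact H)
    (groupConv (Measure.dirac h) (haarOfCompact H)))).map ((↑) : G → G ⧸ H)

/-- `μ` is `H`-biinvariant: `μ = ω_H * μ * ω_H`. -/
def IsBiinvariant (H : Subgroup G) [CompactSpace H] (μ : Measure G) : Prop :=
  groupConv (haarOfCompact H) (groupConv μ (haarOfCompact H)) = μ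

/-- `𝓗` is the double coset hypergroup `G//H`: its identity is `HeH`, its involution is
`HgH ↦ Hg⁻¹H`, and its convolution is the convolution of `H`-biinvariant bounded regular
measures on `G`, transferred by the push forward along `G → G//H`. (The push forward is a
bijection of the biinvariant bounded measures on `G` onto the bounded measures on `G//H` which
respects positivity; as the convolutions are bilinear, it suffices to consider positive
measures.) -/
structure IsDoubleCosetHypergroup (H : Subgroup G) [CompactSpace H]
    [MeasurableSpace (DoubleCoset.Quotient (H : Set G) (H : Set G))]
    [BorelSpace (DoubleCoset.Quotient (H : Set G) (H : Set G))]
    (𝓗 : Hypergroup (DoubleCoset.Quotient (H : Set G) (H : Set G))) : Prop where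
  e_eq : 𝓗.e = DoubleCoset.mk H H 1
  inv_eq : ∀ g : G, 𝓗.inv (DoubleCoset.mk H H g) = DoubleCoset.mk H H g⁻¹
  posConv_eq : ∀ μ ν : FiniteMeasure G, (μ : Measure G).Regular → (ν : Measure G).Regular →
    IsBiinvariant H μ → IsBiinvariant H ν →
    (𝓗.posConv (μ.map (DoubleCoset.mk H H)) (ν.map (DoubleCoset.mk H H)) : Measure _) =
      (groupConv (μ : Measure G) (ν : Measure G)).map (DoubleCoset.mk H H)

end Group

end

/-! Everything is an average over an element `a` of `H` distributed by normalized Haar measure. The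
kernel at (xH, HhH) is the law of xahH (`cosetKernel_eq_map`), and δ_{HxH} * δ_{HyH} is the law of
HxayH. Haar measure of a compact group is two-sided invariant, so these laws do not depend on the
representatives (`cosetTransition_mk`, `doubleCosetTransition_mk`).

Since xahH is jointly continuous in (x, h, a) and `H` is compact, integrals of continuous functions
and the supports {xahH : a ∈ H} vary continuously with (x, h); both facts descend along the open
quotient map G × G → G/H × G//H. Measurability descends the same way, through lower semicontinuity
on open sets. The supports partition G/H because yH = xahH for some `a` exactly when HhH = Hx⁻¹yH,
which also identifies π.

The law of xacbdH with independent `a`, `b` in `H` can be integrated in either order: this is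
Chapman–Kolmogorov (`lintegral_cosetTransition_comp`), and its image in G//H is associativity of the
convolution. A Markov kernel with associativity and the Feller property yields a bilinear, weakly
continuous convolution of complex measures (`MeasureConvolution.ofKernel`). For (T1), both sides are
the average of f(Hx⁻¹yahH).

Compactness of `H` makes the projections closed and proper, so Haar measure of `G` pushes forward to
Radon measures on G/H and G//H. By unimodularity a Haar integral is unchanged by averaging over
translations y ↦ u(a) y v(a) (`integral_haar_translate`); suitable u, v give both Haar properties on
G//H, the adjoint relation on G/H, and (T2).

Only G/H, not `G`, is second countable in (c). Joint measurability for Tonelli is therefore obtained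
by factoring maps through G/H. -/

set_option linter.unusedSectionVars false

noncomputable section

/-! ### Push forwards of a fixed measure along continuous families of maps -/

section Averages

open Set Filter Topology
open scoped ENNReal NNReal

variable {P Q Y T : Type*} [TopologicalSpace P] [TopologicalSpace Q] [TopologicalSpace Y]
  [TopologicalSpace T] [MeasurableSpace T] [BorelSpace T] [MeasurableSpace Y] [BorelSpace Y]

/-- The measure that a continuously varying map gives to an open set is lower semicontinuous. -/
theorem isOpen_setOf_lt_measure_preimage {P T Y : Type*} [TopologicalSpace P]
    [TopologicalSpace T] [TopologicalSpace Y] [MeasurableSpace T] (ν : Measure T) [ν.Regular]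
    {φ : P → T → Y} (hφ : Continuous φ.uncurry) {U : Set Y} (hU : IsOpen U) (t : ℝ≥0∞) :
    IsOpen {p | t < ν (φ p ⁻¹' U)} := by
  rw [isOpen_iff_mem_nhds]
  intro p hp
  have hpU : IsOpen (φ p ⁻¹' U) := hU.preimage (hφ.comp (Continuous.prodMk_right p))
  obtain ⟨C, hCU, hC, htC⟩ := hpU.exists_lt_isCompact hp
  obtain ⟨u, v, hu, -, hpu, hCv, huv⟩ := generalized_tube_lemma (isCompact_singleton (x := p)) hC
    (hU.preimage hφ) (by rintro ⟨a, b⟩ ⟨rfl, hb⟩; exact hCU hb)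
  filter_upwards [hu.mem_nhds (hpu rfl)] with p' hp'
  exact htC.trans_le (measure_mono fun c hc =>
    show (p', c) ∈ φ.uncurry ⁻¹' U from huv ⟨hp', hCv hc⟩)

/-- Lower semicontinuity gives Borel measurability on open sets, a π-system generating the
σ-algebra; finiteness of the measures then extends it to all Borel sets. -/
theorem measurable_of_isOpen_setOf_lt [MeasurableSpace Q] [OpensMeasurableSpace Q]
    {κ : Q → Measure Y} [∀ x, IsFiniteMeasure (κ x)]
    (h : ∀ U : Set Y, IsOpen U → ∀ t : ℝ≥0∞, IsOpen {x | t < κ x U}) : Measurable κ :=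
  have key : ∀ U : Set Y, IsOpen U → Measurable fun x => κ x U := fun U hU =>
    measurable_of_Ioi fun t => (h U hU t).measurableSet
  Measurable.measure_of_isPiSystem (BorelSpace.measurable_eq (α := Y)) isPiSystem_isOpen
    key (key univ isOpen_univ)

theorem measurable_map_of_continuous [MeasurableSpace P] [OpensMeasurableSpace P]
    (ν : Measure T) [ν.Regular] [IsFiniteMeasure ν] {φ : P → T → Y}
    (hφ : Continuous φ.uncurry) : Measurable fun p => ν.map (φ p) := by
  refine measurable_of_isOpen_setOf_lt fun U hU t => ?_
  have hm : ∀ p, Measurable (φ p) := fun p => (hφ.comp (Continuous.prodMk_right p)).measurable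
  simp_rw [Measure.map_apply (hm _) hU.measurableSet]
  exact isOpen_setOf_lt_measure_preimage ν hφ hU t

/-- The two halves of the Vietoris topology: the parameters whose range leaves an open set form the
projection of a closed set along the compact factor, hence a closed set; those whose range lies in a
closed set form an intersection of closed conditions. -/
theorem continuous_rangeCompacts {P T Y : Type*} [TopologicalSpace P] [TopologicalSpace T]
    [TopologicalSpace Y] [CompactSpace T] {φ : P → T → Y} (hφ : Continuous φ.uncurry) :
    Continuous fun p => (⟨range (φ p),
      isCompact_range (hφ.comp (Continuous.prodMk_right p))⟩ : Compacts Y) := by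
  let _ := TopologicalSpace.vietoris Y
  refine Compacts.isEmbedding_coe.continuous_iff.2 (vietoris.continuous_iff.2
    ⟨fun U hU => ?_, fun F hF => ?_⟩)
  · have : IsClosed (Prod.fst '' (φ.uncurry ⁻¹' Uᶜ)) :=
      isClosedMap_fst_of_compactSpace _ (hU.isClosed_compl.preimage hφ)
    convert this.isOpen_compl using 1
    ext p
    simp [range_subset_iff, Set.mem_powerset_iff]
  · have : IsClosed (⋂ a, (fun p => φ p a) ⁻¹' F) := isClosed_iInter fun a =>
      hF.preimage (hφ.comp (Continuous.prodMk_left a))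
    convert this using 1
    ext p
    simp [range_subset_iff, Set.mem_powerset_iff]

theorem support_map_of_continuous [CompactSpace T] [T2Space Y] (ν : Measure T)
    [ν.IsOpenPosMeasure] {f : T → Y} (hf : Continuous f) : (ν.map f).support = range f := by
  apply Subset.antisymm
  · refine Measure.support_subset_of_isClosed (isCompact_range hf).isClosed ?_
    rw [mem_ae_iff, Measure.map_apply hf.measurable
      (isCompact_range hf).isClosed.measurableSet.compl]
    simp
  · rintro _ ⟨a, rfl⟩
    rw [Measure.mem_support_iff_forall]
    intro U hU
    obtain ⟨V, hVU, hV, haV⟩ := mem_nhds_iff.1 hU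
    refine lt_of_lt_of_le ?_ (measure_mono hVU)
    rw [Measure.map_apply hf.measurable hV.measurableSet]
    exact (hV.preimage hf).measure_pos ν ⟨a, haV⟩

/-- Openness of {x | t < κ x U} can be tested upstairs because `r` is a quotient map. No measurable
choice of representatives is needed. -/
theorem measurable_of_quotient [MeasurableSpace Q] [OpensMeasurableSpace Q]
    (ν : Measure T) [ν.Regular] [IsFiniteMeasure ν] {φ : P → T → Y}
    (hφ : Continuous φ.uncurry) {r : P → Q} (hr : IsOpenQuotientMap r) {κ : Q → Measure Y}
    (hκ : ∀ p, κ (r p) = ν.map (φ p)) : Measurable κ := by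
  have hm : ∀ p, Measurable (φ p) := fun p => (hφ.comp (Continuous.prodMk_right p)).measurable
  have : ∀ x, IsFiniteMeasure (κ x) := fun x => by
    obtain ⟨p, rfl⟩ := hr.surjective x
    rw [hκ]; infer_instance
  refine measurable_of_isOpen_setOf_lt fun U hU t => ?_
  rw [← hr.isQuotientMap.isOpen_preimage]
  simp_rw [preimage_ofPred_eq, hκ, Measure.map_apply (hm _) hU.measurableSet]
  exact isOpen_setOf_lt_measure_preimage ν hφ hU t

theorem continuous_integral_of_quotient [SecondCountableTopology Y] [PseudoMetrizableSpace Y]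
    [CompactSpace T] (ν : Measure T) [IsFiniteMeasureOnCompacts ν] {φ : P → T → Y}
    (hφ : Continuous φ.uncurry) {r : P → Q} (hr : IsOpenQuotientMap r) {κ : Q → Measure Y}
    (hκ : ∀ p, κ (r p) = ν.map (φ p))
    {E : Type*} [NormedAddCommGroup E] [NormedSpace ℝ E] {f : Y → E}
    (hf : Continuous f) : Continuous fun x => ∫ y, f y ∂(κ x) := by
  have hm : ∀ p, Measurable (φ p) := fun p => (hφ.comp (Continuous.prodMk_right p)).measurable
  rw [hr.isQuotientMap.continuous_iff, ← continuousOn_univ]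
  have : ((fun x => ∫ y, f y ∂(κ x)) ∘ r) = fun p => ∫ a, f (φ p a) ∂ν := by
    ext p
    simp only [Function.comp, hκ]
    exact integral_map (hm p).aemeasurable
      hf.aestronglyMeasurable
  rw [this]
  exact continuousOn_integral_of_compact_support isCompact_univ
    (hf.comp hφ).continuousOn (by simp)

theorem hasContinuousCompactSupport_of_quotient [T2Space Y] [CompactSpace T]
    (ν : Measure T) [ν.IsOpenPosMeasure] {φ : P → T → Y}
    (hφ : Continuous φ.uncurry) {r : P → Q} (hr : IsOpenQuotientMap r) {κ : Q → Measure Y}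
    (hκ : ∀ p, κ (r p) = ν.map (φ p)) :
    HasContinuousCompactSupport κ := by
  have hS : ∀ x, IsCompact (κ x).support := fun x => by
    obtain ⟨p, rfl⟩ := hr.surjective x
    have hp : Continuous (φ p) := hφ.comp (Continuous.prodMk_right p)
    rw [hκ, support_map_of_continuous ν hp]
    exact isCompact_range hp
  refine ⟨fun x => ⟨(κ x).support, hS x⟩, ?_, fun x => rfl⟩
  rw [hr.isQuotientMap.continuous_iff]
  convert continuous_rangeCompacts hφ using 2 with p
  ext1
  simp only [Function.comp, Compacts.coe_mk, hκ]
  exact support_map_of_continuous ν (hφ.comp (Continuous.prodMk_right p))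

end Averages

/-! ### Weak continuity of the product of finite measures -/

section FiniteMeasureProd

open Filter Topology
open scoped ENNReal NNReal

variable {α β : Type*} [MeasurableSpace α] [MeasurableSpace β]

theorem MeasureTheory.FiniteMeasure.normalize_prod [Nonempty α] [Nonempty β]
    {μ : FiniteMeasure α} {ν : FiniteMeasure β} (hμ : μ ≠ 0) (hν : ν ≠ 0) :
    (μ.prod ν).normalize = μ.normalize.prod ν.normalize := by
  have hμν : μ.prod ν ≠ 0 := by
    rw [← FiniteMeasure.mass_nonzero_iff, FiniteMeasure.mass_prod]
    exact mul_ne_zero (μ.mass_nonzero_iff.2 hμ) (ν.mass_nonzero_iff.2 hν)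
  apply Subtype.ext
  change ((μ.prod ν).normalize : Measure (α × β)) =
    (μ.normalize : Measure α).prod (ν.normalize : Measure β)
  rw [FiniteMeasure.toMeasure_normalize_eq_of_nonzero _ hμν,
    FiniteMeasure.toMeasure_normalize_eq_of_nonzero _ hμ,
    FiniteMeasure.toMeasure_normalize_eq_of_nonzero _ hν, FiniteMeasure.mass_prod,
    Measure.prod_smul_left, Measure.prod_smul_right, smul_smul, mul_inv]
  rfl

/-- Normalization reduces this to probability measures, since masses multiply and vary continuously.
Where the limit product is zero, convergence of the mass to zero is already enough. -/
theorem MeasureTheory.FiniteMeasure.continuous_prod [TopologicalSpace α] [TopologicalSpace β]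
    [SecondCountableTopology α] [SecondCountableTopology β] [PseudoMetrizableSpace α]
    [PseudoMetrizableSpace β] [OpensMeasurableSpace α] [OpensMeasurableSpace β] :
    Continuous fun p : FiniteMeasure α × FiniteMeasure β => p.1.prod p.2 := by
  rw [continuous_iff_continuousAt]
  rintro ⟨μ, ν⟩
  have hmass : Tendsto (fun p : FiniteMeasure α × FiniteMeasure β => (p.1.prod p.2).mass)
      (𝓝 (μ, ν)) (𝓝 (μ.prod ν).mass) := by
    simp only [FiniteMeasure.mass_prod]
    exact (FiniteMeasure.continuous_mass.comp continuous_fst).tendsto (μ, ν) |>.mul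
      ((FiniteMeasure.continuous_mass.comp continuous_snd).tendsto (μ, ν))
  by_cases h0 : μ.prod ν = 0
  · rw [h0, FiniteMeasure.zero_mass] at hmass
    change Tendsto _ _ (𝓝 (μ.prod ν))
    rw [h0]
    exact FiniteMeasure.tendsto_zero_of_tendsto_zero_mass hmass
  have hμ : μ ≠ 0 := by rintro rfl; exact h0 (FiniteMeasure.zero_prod _)
  have hν : ν ≠ 0 := by rintro rfl; exact h0 (FiniteMeasure.prod_zero _)
  have : Nonempty α := by
    by_contra h
    rw [not_nonempty_iff] at h
    exact hμ (Subtype.ext (Measure.eq_zero_of_isEmpty _))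
  have : Nonempty β := by
    by_contra h
    rw [not_nonempty_iff] at h
    exact hν (Subtype.ext (Measure.eq_zero_of_isEmpty _))
  refine FiniteMeasure.tendsto_of_tendsto_normalize_testAgainstNN_of_tendsto_mass ?_ hmass
  rw [FiniteMeasure.normalize_prod hμ hν]
  have h1 : Tendsto (fun p : FiniteMeasure α × FiniteMeasure β => p.1.normalize) (𝓝 (μ, ν))
      (𝓝 μ.normalize) :=
    FiniteMeasure.tendsto_normalize_of_tendsto continuous_fst.continuousAt hμ
  have h2 : Tendsto (fun p : FiniteMeasure α × FiniteMeasure β => p.2.normalize) (𝓝 (μ, ν))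
      (𝓝 ν.normalize) :=
    FiniteMeasure.tendsto_normalize_of_tendsto continuous_snd.continuousAt hν
  have h := (ProbabilityMeasure.continuous_prod.tendsto (μ.normalize, ν.normalize)).comp
    (h1.prodMk_nhds h2)
  refine h.congr' ?_
  have e1 : ∀ᶠ p : FiniteMeasure α × FiniteMeasure β in 𝓝 (μ, ν), p.1.mass ≠ 0 :=
    (FiniteMeasure.continuous_mass.comp continuous_fst).continuousAt.eventually_ne
      (μ.mass_nonzero_iff.2 hμ)
  have e2 : ∀ᶠ p : FiniteMeasure α × FiniteMeasure β in 𝓝 (μ, ν), p.2.mass ≠ 0 :=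
    (FiniteMeasure.continuous_mass.comp continuous_snd).continuousAt.eventually_ne
      (ν.mass_nonzero_iff.2 hν)
  filter_upwards [e1, e2] with p hp1 hp2
  exact (FiniteMeasure.normalize_prod (p.1.mass_nonzero_iff.1 hp1)
    (p.2.mass_nonzero_iff.1 hp2)).symm

end FiniteMeasureProd

/-! ### Linear extension from finite to complex measures -/

section ComplexExtension

open scoped ENNReal NNReal

variable {D : Type*} [MeasurableSpace D]

/-- The positive part of a signed measure, as a finite measure. -/
def MeasureTheory.SignedMeasure.posFM (s : SignedMeasure D) : FiniteMeasure D :=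
  ⟨s.toJordanDecomposition.posPart, inferInstance⟩

/-- The negative part of a signed measure, as a finite measure. -/
def MeasureTheory.SignedMeasure.negFM (s : SignedMeasure D) : FiniteMeasure D :=
  ⟨s.toJordanDecomposition.negPart, inferInstance⟩

/-- A finite measure as a signed measure. -/
def MeasureTheory.FiniteMeasure.toSigned (μ : FiniteMeasure D) : SignedMeasure D :=
  (μ : Measure D).toSignedMeasure

namespace MeasureTheory.FiniteMeasure

theorem toSigned_add (μ ν : FiniteMeasure D) : (μ + ν).toSigned = μ.toSigned + ν.toSigned :=
  Measure.toSignedMeasure_add _ _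

theorem toSigned_smul (c : ℝ≥0) (μ : FiniteMeasure D) :
    (c • μ).toSigned = c • μ.toSigned :=
  Measure.toSignedMeasure_smul _ _

theorem toSigned_zero : (0 : FiniteMeasure D).toSigned = 0 :=
  Measure.toSignedMeasure_zero

theorem toSigned_injective : Function.Injective (toSigned (D := D)) := fun μ ν h =>
  Subtype.ext ((Measure.toSignedMeasure_eq_toSignedMeasure_iff (μ := (μ : Measure D))
    (ν := (ν : Measure D))).1 h)

theorem _root_.MeasureTheory.SignedMeasure.posFM_sub_negFM (s : SignedMeasure D) :
    s.posFM.toSigned - s.negFM.toSigned = s :=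
  s.toSignedMeasure_toJordanDecomposition

variable {V : Type*} [AddCommGroup V] [Module ℂ V]

/-- The extension of a function of finite measures to signed measures. -/
def signedExtension (f : FiniteMeasure D → V) (s : SignedMeasure D) : V := f s.posFM - f s.negFM

variable {f : FiniteMeasure D → V}

/-- Any decomposition as a difference of finite measures gives the same value as the Jordan
decomposition: cross-adding the two differences yields equal finite measures, to which additivity
applies. -/
theorem signedExtension_sub (hadd : ∀ μ ν, f (μ + ν) = f μ + f ν) (a b : FiniteMeasure D) :
    signedExtension f (a.toSigned - b.toSigned) = f a - f b := by
  set s := a.toSigned - b.toSigned with hs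
  have h : s.posFM + b = a + s.negFM := toSigned_injective <| by
    have := s.posFM_sub_negFM
    rw [toSigned_add, toSigned_add]
    rw [sub_eq_iff_eq_add] at this
    rw [this, hs]
    abel
  have := congrArg f h
  rw [hadd, hadd] at this
  rw [signedExtension, sub_eq_sub_iff_add_eq_add, this]

theorem signedExtension_add (hadd : ∀ μ ν, f (μ + ν) = f μ + f ν) (s t : SignedMeasure D) :
    signedExtension f (s + t) = signedExtension f s + signedExtension f t := by
  have : s + t = (s.posFM + t.posFM).toSigned - (s.negFM + t.negFM).toSigned := by
    conv_lhs => rw [← s.posFM_sub_negFM, ← t.posFM_sub_negFM]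
    rw [toSigned_add, toSigned_add]
    abel
  rw [this, signedExtension_sub hadd, hadd, hadd, signedExtension, signedExtension]
  abel

theorem signedExtension_smul (hadd : ∀ μ ν, f (μ + ν) = f μ + f ν)
    (hsmul : ∀ (c : ℝ≥0) μ, f (c • μ) = ((c : ℝ) : ℂ) • f μ) (c : ℝ) (s : SignedMeasure D) :
    signedExtension f (c • s) = (c : ℂ) • signedExtension f s := by
  have key : ∀ (c : ℝ≥0) (s : SignedMeasure D),
      signedExtension f ((c : ℝ) • s) = ((c : ℝ) : ℂ) • signedExtension f s := fun c s => by
    have : (c : ℝ) • s = (c • s.posFM).toSigned - (c • s.negFM).toSigned := by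
      conv_lhs => rw [← s.posFM_sub_negFM]
      rw [toSigned_smul, toSigned_smul, smul_sub]
      rfl
    rw [this, signedExtension_sub hadd, hsmul, hsmul, signedExtension, smul_sub]
  -- Negation exchanges the two parts; this is what covers negative scalars, as `f` is only
  -- positively homogeneous.
  have hneg : ∀ s : SignedMeasure D, signedExtension f (-s) = -signedExtension f s := fun s => by
    have : -s = s.negFM.toSigned - s.posFM.toSigned := by
      conv_lhs => rw [← s.posFM_sub_negFM]
      rw [neg_sub]
    rw [this, signedExtension_sub hadd, signedExtension, neg_sub]
  rcases le_total 0 c with hc | hc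
  · exact key ⟨c, hc⟩ s
  · have h := key ⟨-c, neg_nonneg.2 hc⟩ s
    change signedExtension f (-c • s) = ((-c : ℝ) : ℂ) • signedExtension f s at h
    have e : -c • s = -(c • s) := by
      ext A hA
      simp
    rw [e, hneg, Complex.ofReal_neg, neg_smul] at h
    exact neg_injective h

/-- An additive, positively homogeneous map on the finite measures extends to a linear map on the
complex measures. -/
theorem exists_linearMap_toComplex (hadd : ∀ μ ν, f (μ + ν) = f μ + f ν)
    (hsmul : ∀ (c : ℝ≥0) μ, f (c • μ) = ((c : ℝ) : ℂ) • f μ) :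
    ∃ F : ComplexMeasure D →ₗ[ℂ] V, ∀ μ : FiniteMeasure D, F μ.toComplex = f μ := by
  refine ⟨{ toFun := fun c => signedExtension f c.re + Complex.I • signedExtension f c.im
            map_add' := fun c d => ?_
            map_smul' := fun z c => ?_ }, fun μ => ?_⟩
  · rw [LinearMap.map_add, LinearMap.map_add, signedExtension_add hadd,
      signedExtension_add hadd, smul_add]
    abel
  · have hre : ComplexMeasure.re (z • c) = z.re • c.re + (-z.im) • c.im := by
      ext A hA
      change ((z • c) A).re = z.re * (c A).re + -z.im * (c A).im
      simp [sub_eq_add_neg]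
    have him : ComplexMeasure.im (z • c) = z.re • c.im + z.im • c.re := by
      ext A hA
      change ((z • c) A).im = z.re * (c A).im + z.im * (c A).re
      simp
    rw [hre, him, signedExtension_add hadd, signedExtension_add hadd]
    simp only [signedExtension_smul hadd hsmul, RingHom.id_apply]
    generalize signedExtension f _ = u
    generalize signedExtension f _ = v
    have hz := Complex.re_add_im z
    push_cast
    match_scalars
    · linear_combination hz
    · linear_combination Complex.I * hz - (z.im : ℂ) * Complex.I_sq
  · have h0 : signedExtension f 0 = 0 := by
      have := signedExtension_smul hadd hsmul 0 0
      simpa using this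
    have h1 : signedExtension f μ.toSigned = f μ := by
      have := signedExtension_sub hadd μ 0
      have hf0 : f 0 = 0 := by simpa using hsmul 0 0
      simpa [toSigned_zero, hf0] using this
    change signedExtension f μ.toSigned + Complex.I • signedExtension f 0 = f μ
    rw [h0, h1, smul_zero, add_zero]

/-- The Jordan parts of the real and imaginary parts exhibit every complex measure as a combination
of four finite measures. -/
theorem linearMap_ext_toComplex {F F' : ComplexMeasure D →ₗ[ℂ] V}
    (h : ∀ μ : FiniteMeasure D, F μ.toComplex = F' μ.toComplex) : F = F' := by
  refine LinearMap.ext fun c => ?_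
  have hc : c = (c.re.posFM.toComplex - c.re.negFM.toComplex) +
      Complex.I • (c.im.posFM.toComplex - c.im.negFM.toComplex) := by
    ext A hA
    have h1 : c.re.posFM.toSigned A - c.re.negFM.toSigned A = (c A).re :=
      congrArg (fun s : SignedMeasure D => s A) c.re.posFM_sub_negFM
    have h2 : c.im.posFM.toSigned A - c.im.negFM.toSigned A = (c A).im :=
      congrArg (fun s : SignedMeasure D => s A) c.im.posFM_sub_negFM
    have h : ∀ μ : FiniteMeasure D, μ.toComplex A = (μ.toSigned A : ℂ) := fun _ => rfl
    change c A = (c.re.posFM.toComplex A - c.re.negFM.toComplex A) +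
      Complex.I * (c.im.posFM.toComplex A - c.im.negFM.toComplex A)
    rw [h, h, h, h, ← Complex.ofReal_sub, ← Complex.ofReal_sub, h1, h2, mul_comm,
      Complex.re_add_im]
  rw [hc]
  simp only [LinearMap.map_add, LinearMap.map_sub, LinearMap.map_smul, h]

theorem toComplex_add (μ ν : FiniteMeasure D) :
    (μ + ν).toComplex = μ.toComplex + ν.toComplex := by
  ext A hA
  apply Complex.ext
  · exact congrArg (fun s : SignedMeasure D => s A) (toSigned_add μ ν)
  · simp [toComplex, SignedMeasure.toComplexMeasure_apply]

theorem toComplex_smul (c : ℝ≥0) (μ : FiniteMeasure D) :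
    (c • μ).toComplex = ((c : ℝ) : ℂ) • μ.toComplex := by
  ext A hA
  apply Complex.ext
  · have := congrArg (fun s : SignedMeasure D => s A) (toSigned_smul c μ)
    change (c • μ).toSigned A = (((c : ℝ) : ℂ) * (μ.toSigned A : ℂ)).re
    rw [Complex.re_ofReal_mul]
    exact this
  · simp [toComplex, SignedMeasure.toComplexMeasure_apply]

end MeasureTheory.FiniteMeasure

end ComplexExtension

/-! ### Convolution of measures generated by a Markov kernel -/

section KernelConvolution

open scoped ENNReal NNReal

variable {D : Type*} [MeasurableSpace D]

/-- The convolution of finite measures with `δ_x * δ_y = κ (x, y)`. -/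
def kernelConv (κ : Kernel (D × D) D) [IsMarkovKernel κ] (μ ν : FiniteMeasure D) :
    FiniteMeasure D :=
  ⟨((μ : Measure D).prod (ν : Measure D)).bind κ, inferInstance⟩

variable (κ : Kernel (D × D) D) [IsMarkovKernel κ]

theorem lintegral_kernelConv (μ ν : FiniteMeasure D) {f : D → ℝ≥0∞} (hf : Measurable f) :
    ∫⁻ z, f z ∂(kernelConv κ μ ν : Measure D) =
      ∫⁻ x, ∫⁻ y, ∫⁻ z, f z ∂(κ (x, y)) ∂(ν : Measure D) ∂(μ : Measure D) := by
  change ∫⁻ z, f z ∂(((μ : Measure D).prod (ν : Measure D)).bind κ) = _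
  rw [Measure.lintegral_bind κ.aemeasurable hf.aemeasurable,
    lintegral_prod _ hf.lintegral_kernel.aemeasurable]

theorem kernelConv_apply (μ ν : FiniteMeasure D) {A : Set D} (hA : MeasurableSet A) :
    (kernelConv κ μ ν : Measure D) A =
      ∫⁻ x, ∫⁻ y, κ (x, y) A ∂(ν : Measure D) ∂(μ : Measure D) := by
  rw [← lintegral_indicator_one hA, lintegral_kernelConv κ μ ν (measurable_one.indicator hA)]
  simp_rw [lintegral_indicator_one hA]

theorem kernelConv_dirac (x y : D) :
    (kernelConv κ (diracFM x) (diracFM y) : Measure D) = κ (x, y) := by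
  ext A hA
  have h : Measurable fun p => κ p A := κ.measurable_coe hA
  rw [kernelConv_apply κ _ _ hA]
  change ∫⁻ x, ∫⁻ y, κ (x, y) A ∂(Measure.dirac y) ∂(Measure.dirac x) = _
  rw [lintegral_dirac' _ (h.lintegral_prod_right' (ν := Measure.dirac y)),
    lintegral_dirac' _ (show Measurable fun y => κ (x, y) A from h.comp measurable_prodMk_left)]

theorem finiteMeasure_ext {μ ν : FiniteMeasure D}
    (h : ∀ A, MeasurableSet A → (μ : Measure D) A = (ν : Measure D) A) : μ = ν :=
  Subtype.ext (Measure.ext h)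

theorem kernelConv_add_left (μ μ' ν : FiniteMeasure D) :
    kernelConv κ (μ + μ') ν = kernelConv κ μ ν + kernelConv κ μ' ν := by
  refine finiteMeasure_ext fun A hA => ?_
  rw [FiniteMeasure.toMeasure_add, Measure.add_apply, kernelConv_apply κ _ _ hA,
    kernelConv_apply κ _ _ hA, kernelConv_apply κ _ _ hA, FiniteMeasure.toMeasure_add,
    lintegral_add_measure]

theorem kernelConv_add_right (μ ν ν' : FiniteMeasure D) :
    kernelConv κ μ (ν + ν') = kernelConv κ μ ν + kernelConv κ μ ν' := by
  refine finiteMeasure_ext fun A hA => ?_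
  have h : Measurable fun p => κ p A := κ.measurable_coe hA
  rw [FiniteMeasure.toMeasure_add, Measure.add_apply, kernelConv_apply κ _ _ hA,
    kernelConv_apply κ _ _ hA, kernelConv_apply κ _ _ hA, FiniteMeasure.toMeasure_add]
  simp_rw [lintegral_add_measure]
  exact lintegral_add_left (h.lintegral_prod_right' (ν := (ν : Measure D))) _

theorem kernelConv_smul_left (c : ℝ≥0) (μ ν : FiniteMeasure D) :
    kernelConv κ (c • μ) ν = c • kernelConv κ μ ν := by
  refine finiteMeasure_ext fun A hA => ?_
  rw [FiniteMeasure.toMeasure_smul, Measure.smul_apply, kernelConv_apply κ _ _ hA,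
    kernelConv_apply κ _ _ hA, FiniteMeasure.toMeasure_smul, lintegral_smul_measure]

theorem kernelConv_smul_right (c : ℝ≥0) (μ ν : FiniteMeasure D) :
    kernelConv κ μ (c • ν) = c • kernelConv κ μ ν := by
  refine finiteMeasure_ext fun A hA => ?_
  have h : Measurable fun p => κ p A := κ.measurable_coe hA
  rw [FiniteMeasure.toMeasure_smul, Measure.smul_apply, kernelConv_apply κ _ _ hA,
    kernelConv_apply κ _ _ hA, FiniteMeasure.toMeasure_smul]
  simp_rw [lintegral_smul_measure, ENNReal.smul_def, smul_eq_mul]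
  exact lintegral_const_mul _ (h.lintegral_prod_right' (ν := (ν : Measure D)))

/-- On a set both sides become iterated integrals over μ, ν, ρ; pointwise associativity matches the
integrands once Tonelli exchanges the kernel integral with the one over ρ. -/
theorem kernelConv_assoc
    (hκ : ∀ x y z A, MeasurableSet A →
      ∫⁻ w, κ (w, z) A ∂(κ (x, y)) = ∫⁻ w, κ (x, w) A ∂(κ (y, z)))
    (μ ν ρ : FiniteMeasure D) :
    kernelConv κ (kernelConv κ μ ν) ρ = kernelConv κ μ (kernelConv κ ν ρ) := by
  refine finiteMeasure_ext fun A hA => ?_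
  have h : Measurable fun p => κ p A := κ.measurable_coe hA
  rw [kernelConv_apply κ _ _ hA, kernelConv_apply κ _ _ hA,
    lintegral_kernelConv κ _ _ (h.lintegral_prod_right' (ν := (ρ : Measure D)))]
  have h' : ∀ x, Measurable fun w => κ (x, w) A := fun x => h.comp measurable_prodMk_left
  simp_rw [lintegral_kernelConv κ ν ρ (h' _), ← hκ _ _ _ _ hA]
  refine lintegral_congr fun x => lintegral_congr fun y => ?_
  exact lintegral_lintegral_swap h.aemeasurable

theorem exists_bilinear_kernelConv :
    ∃ B : ComplexMeasure D →ₗ[ℂ] ComplexMeasure D →ₗ[ℂ] ComplexMeasure D,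
      ∀ μ ν : FiniteMeasure D, B μ.toComplex ν.toComplex = (kernelConv κ μ ν).toComplex := by
  have h1 : ∀ μ : FiniteMeasure D, ∃ F : ComplexMeasure D →ₗ[ℂ] ComplexMeasure D,
      ∀ ν : FiniteMeasure D, F ν.toComplex = (kernelConv κ μ ν).toComplex := fun μ =>
    FiniteMeasure.exists_linearMap_toComplex
      (fun ν ν' => by rw [kernelConv_add_right, FiniteMeasure.toComplex_add])
      (fun c ν => by rw [kernelConv_smul_right, FiniteMeasure.toComplex_smul])
  choose F hF using h1
  obtain ⟨B, hB⟩ := FiniteMeasure.exists_linearMap_toComplex (f := F)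
    (fun μ μ' => FiniteMeasure.linearMap_ext_toComplex fun ν => by
      rw [LinearMap.add_apply, hF, hF, hF, kernelConv_add_left, FiniteMeasure.toComplex_add])
    (fun c μ => FiniteMeasure.linearMap_ext_toComplex fun ν => by
      rw [LinearMap.smul_apply, hF, hF, kernelConv_smul_left, FiniteMeasure.toComplex_smul])
  exact ⟨B, fun μ ν => by rw [hB, hF]⟩

/-- The bilinear extension of `kernelConv` to complex measures. -/
def complexKernelConv : ComplexMeasure D →ₗ[ℂ] ComplexMeasure D →ₗ[ℂ] ComplexMeasure D :=
  (exists_bilinear_kernelConv κ).choose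

theorem complexKernelConv_toComplex (μ ν : FiniteMeasure D) :
    complexKernelConv κ μ.toComplex ν.toComplex = (kernelConv κ μ ν).toComplex :=
  (exists_bilinear_kernelConv κ).choose_spec μ ν

theorem complexKernelConv_assoc
    (hκ : ∀ x y z A, MeasurableSet A →
      ∫⁻ w, κ (w, z) A ∂(κ (x, y)) = ∫⁻ w, κ (x, w) A ∂(κ (y, z)))
    (μ ν ρ : ComplexMeasure D) :
    complexKernelConv κ (complexKernelConv κ μ ν) ρ =
      complexKernelConv κ μ (complexKernelConv κ ν ρ) := by
  set B := complexKernelConv κ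
  have hB : ∀ μ ν : FiniteMeasure D, B μ.toComplex ν.toComplex = (kernelConv κ μ ν).toComplex :=
    complexKernelConv_toComplex κ
  -- Both sides are linear in each variable, so associativity passes from finite to complex measures
  -- one variable at a time, starting from the last.
  have h1 : ∀ (μ ν : FiniteMeasure D) (ρ : ComplexMeasure D),
      B (B μ.toComplex ν.toComplex) ρ = B μ.toComplex (B ν.toComplex ρ) := fun μ ν =>
    LinearMap.congr_fun (f := B (B μ.toComplex ν.toComplex))
      (g := B μ.toComplex ∘ₗ B ν.toComplex) <| FiniteMeasure.linearMap_ext_toComplex fun ρ => by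
        rw [LinearMap.comp_apply, hB, hB, hB, hB, kernelConv_assoc κ hκ]
  have h2 : ∀ (μ : FiniteMeasure D) (ν ρ : ComplexMeasure D),
      B (B μ.toComplex ν) ρ = B μ.toComplex (B ν ρ) := fun μ ν ρ =>
    LinearMap.congr_fun (f := B.flip ρ ∘ₗ B μ.toComplex) (g := B μ.toComplex ∘ₗ B.flip ρ)
      (FiniteMeasure.linearMap_ext_toComplex fun ν => h1 μ ν ρ) ν
  exact LinearMap.congr_fun (f := B.flip ρ ∘ₗ B.flip ν) (g := B.flip (B ν ρ))
    (FiniteMeasure.linearMap_ext_toComplex fun μ => h2 μ ν ρ) μ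

variable [TopologicalSpace D] [BorelSpace D] [SecondCountableTopology D]
  [PseudoMetrizableSpace D]

/-- By the Feller property, integrating `f` against the convolution is integrating a bounded
continuous function on D × D against the product measure, which depends continuously on its factors.
-/
theorem continuous_kernelConv
    (hκ : ∀ f : D →ᵇ ℝ, Continuous fun p => ∫ z, f z ∂(κ p)) :
    Continuous fun p : FiniteMeasure D × FiniteMeasure D => kernelConv κ p.1 p.2 := by
  rw [FiniteMeasure.continuous_iff_forall_continuous_integral]
  intro f
  let g : D × D →ᵇ ℝ := BoundedContinuousFunction.ofNormedAddCommGroup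
    (fun p => ∫ z, f z ∂(κ p)) (hκ f) ‖f‖ fun p => by
      simpa using norm_integral_le_of_norm_le_const (μ := κ p) (.of_forall f.norm_coe_le_norm)
  have : ∀ p : FiniteMeasure D × FiniteMeasure D,
      ∫ z, f z ∂(kernelConv κ p.1 p.2 : Measure D) = ∫ q, g q ∂(p.1.prod p.2 : Measure (D × D)) :=
    fun p => by
      have h : (kernelConv κ p.1 p.2 : Measure D) =
          (κ ∘ₖ Kernel.const Unit (p.1.prod p.2 : Measure (D × D))) () := by
        rw [Kernel.comp_apply, Kernel.const_apply]; rfl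
      have hf : Integrable f (kernelConv κ p.1 p.2 : Measure D) := f.integrable _
      rw [h] at hf ⊢
      rw [Kernel.integral_comp hf, Kernel.const_apply]
      rfl
  simp_rw [this]
  exact (FiniteMeasure.continuous_integral_boundedContinuousFunction g).comp
    FiniteMeasure.continuous_prod

/-- The convolution of measures given by an associative Markov kernel with the Feller property. -/
def MeasureConvolution.ofKernel [T2Space D] [LocallyCompactSpace D]
    (hassoc : ∀ x y z A, MeasurableSet A →
      ∫⁻ w, κ (w, z) A ∂(κ (x, y)) = ∫⁻ w, κ (x, w) A ∂(κ (y, z)))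
    (hcont : ∀ f : D →ᵇ ℝ, Continuous fun p => ∫ z, f z ∂(κ p)) : MeasureConvolution D where
  t2Space := inferInstance
  locallyCompactSpace := inferInstance
  secondCountable := inferInstance
  conv := complexKernelConv κ
  conv_assoc := complexKernelConv_assoc κ hassoc
  posConv := kernelConv κ
  conv_toComplex := complexKernelConv_toComplex κ
  continuous_posConv := continuous_kernelConv κ hcont

end KernelConvolution

/-! ### Topology of G/H and G//H -/

section DoubleCosetSpace

open scoped ENNReal NNReal Pointwise Topology

/-- The space `G//H` of double cosets. -/
abbrev DoubleCosetSpace {G : Type*} [Group G] (H : Subgroup G) : Type _ :=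
  DoubleCoset.Quotient (H : Set G) (H : Set G)

variable {G : Type*} [Group G] [TopologicalSpace G] [IsTopologicalGroup G] (H : Subgroup G)

theorem doubleCosetMk_mul_left {a : G} (ha : a ∈ H) (x : G) :
    DoubleCoset.mk H H (a * x) = DoubleCoset.mk H H x :=
  ((DoubleCoset.eq H H _ _).2 ⟨a, ha, 1, H.one_mem, by group⟩).symm

theorem doubleCosetMk_mul_right {a : G} (ha : a ∈ H) (x : G) :
    DoubleCoset.mk H H (x * a) = DoubleCoset.mk H H x :=
  ((DoubleCoset.eq H H _ _).2 ⟨1, H.one_mem, a, ha, by group⟩).symm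

theorem cosetToDoubleCoset_mk (x : G) :
    cosetToDoubleCoset H (x : G ⧸ H) = DoubleCoset.mk H H x := rfl

theorem continuous_doubleCosetMk : Continuous (DoubleCoset.mk H H) := continuous_quotient_mk'

theorem surjective_doubleCosetMk : Function.Surjective (DoubleCoset.mk H H) :=
  Quotient.mk_surjective

theorem preimage_image_doubleCosetMk (s : Set G) :
    DoubleCoset.mk H H ⁻¹' (DoubleCoset.mk H H '' s) = (H : Set G) * s * (H : Set G) := by
  ext y
  simp only [Set.mem_preimage, Set.mem_image, DoubleCoset.eq, Set.mem_mul, SetLike.mem_coe]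
  constructor
  · rintro ⟨x, hx, a, ha, b, hb, rfl⟩
    exact ⟨a * x, ⟨a, ha, x, hx, rfl⟩, b, hb, rfl⟩
  · rintro ⟨_, ⟨a, ha, x, hx, rfl⟩, b, hb, rfl⟩
    exact ⟨x, hx, a, ha, b, hb, rfl⟩

theorem isQuotientMap_doubleCosetMk : Topology.IsQuotientMap (DoubleCoset.mk H H) :=
  isQuotientMap_quot_mk

theorem isOpenMap_doubleCosetMk : IsOpenMap (DoubleCoset.mk H H) := fun s hs => by
  rw [← (isQuotientMap_doubleCosetMk H).isOpen_preimage, preimage_image_doubleCosetMk]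
  exact (hs.mul_left).mul_right

theorem isOpenQuotientMap_doubleCosetMk : IsOpenQuotientMap (DoubleCoset.mk H H) :=
  ⟨surjective_doubleCosetMk H, continuous_doubleCosetMk H, isOpenMap_doubleCosetMk H⟩

theorem continuous_cosetToDoubleCoset : Continuous (cosetToDoubleCoset H) :=
  (QuotientGroup.isQuotientMap_mk H).continuous_iff.2 (continuous_doubleCosetMk H)

theorem image_cosetToDoubleCoset (s : Set (G ⧸ H)) :
    cosetToDoubleCoset H '' s = DoubleCoset.mk H H '' (((↑) : G → G ⧸ H) ⁻¹' s) := by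
  conv_lhs => rw [← Set.image_preimage_eq s QuotientGroup.mk_surjective, Set.image_image]
  rfl

theorem isOpenMap_cosetToDoubleCoset : IsOpenMap (cosetToDoubleCoset H) := fun s hs => by
  rw [image_cosetToDoubleCoset]
  exact isOpenMap_doubleCosetMk H _ (hs.preimage QuotientGroup.continuous_mk)

theorem surjective_cosetToDoubleCoset : Function.Surjective (cosetToDoubleCoset H) := fun d => by
  obtain ⟨x, rfl⟩ := surjective_doubleCosetMk H d
  exact ⟨x, rfl⟩

instance [LocallyCompactSpace G] : LocallyCompactSpace (DoubleCosetSpace H) :=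
  (isOpenQuotientMap_doubleCosetMk H).locallyCompactSpace

theorem isOpenQuotientMap_prod : IsOpenQuotientMap
    (Prod.map ((↑) : G → G ⧸ H) (DoubleCoset.mk H H)) :=
  QuotientGroup.isOpenQuotientMap_mk.prodMap (isOpenQuotientMap_doubleCosetMk H)

theorem secondCountableTopology_doubleCosetSpace [SecondCountableTopology (G ⧸ H)] :
    SecondCountableTopology (DoubleCosetSpace H) :=
  (⟨surjective_cosetToDoubleCoset H, continuous_cosetToDoubleCoset H,
    isOpenMap_cosetToDoubleCoset H⟩ : IsOpenQuotientMap _).isQuotientMap.secondCountableTopology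
    (isOpenMap_cosetToDoubleCoset H)

variable [CompactSpace H]

theorem isCompact_subgroup : IsCompact (H : Set G) := isCompact_iff_compactSpace.2 ‹_›

theorem isClosedMap_cosetMk : IsClosedMap ((↑) : G → G ⧸ H) :=
  QuotientGroup.isClosedMap_coe (isCompact_subgroup H)

theorem isClosedMap_doubleCosetMk : IsClosedMap (DoubleCoset.mk H H) := fun s hs => by
  rw [← (isQuotientMap_doubleCosetMk H).isClosed_preimage, preimage_image_doubleCosetMk]
  exact (hs.mul_left_of_isCompact (isCompact_subgroup H)).mul_right_of_isCompact
    (isCompact_subgroup H)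

theorem isClosedMap_cosetToDoubleCoset : IsClosedMap (cosetToDoubleCoset H) := fun s hs => by
  rw [image_cosetToDoubleCoset]
  exact isClosedMap_doubleCosetMk H _ (hs.preimage QuotientGroup.continuous_mk)

/-- The preimage in `G` of a compact set of cosets of a compact subgroup is compact. -/
theorem isProperMap_cosetMk : IsProperMap ((↑) : G → G ⧸ H) := by
  rw [isProperMap_iff_isClosedMap_and_compact_fibers]
  refine ⟨QuotientGroup.continuous_mk, isClosedMap_cosetMk H, fun y => ?_⟩
  obtain ⟨x, rfl⟩ := QuotientGroup.mk_surjective y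
  convert (isCompact_subgroup H).smul x using 1
  ext z
  rw [Set.mem_preimage, Set.mem_singleton_iff, eq_comm, QuotientGroup.eq,
    Set.mem_smul_set_iff_inv_smul_mem, smul_eq_mul, SetLike.mem_coe]

theorem isProperMap_doubleCosetMk : IsProperMap (DoubleCoset.mk H H) := by
  rw [isProperMap_iff_isClosedMap_and_compact_fibers]
  refine ⟨continuous_doubleCosetMk H, isClosedMap_doubleCosetMk H, fun y => ?_⟩
  obtain ⟨x, rfl⟩ := surjective_doubleCosetMk H y
  rw [← Set.image_singleton, preimage_image_doubleCosetMk]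
  exact ((isCompact_subgroup H).mul isCompact_singleton).mul (isCompact_subgroup H)

variable [T2Space G]

instance : T2Space (G ⧸ H) := by
  rw [t2Space_iff_of_isOpenQuotientMap QuotientGroup.isOpenQuotientMap_mk]
  simp_rw [QuotientGroup.eq]
  exact (isCompact_subgroup H).isClosed.preimage (by fun_prop : Continuous
    fun p : G × G => p.1⁻¹ * p.2)

instance : T2Space (DoubleCosetSpace H) := by
  rw [t2Space_iff_of_isOpenQuotientMap (isOpenQuotientMap_doubleCosetMk H)]
  -- For an open quotient map, Hausdorff means that the equivalence relation is closed. Here it is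
  -- the projection, along the compact group `H`, of the closed condition (ax)⁻¹y ∈ H.
  have h : IsClosed {p : H × (G × G) | ((p.1 : G) * p.2.1)⁻¹ * p.2.2 ∈ (H : Set G)} :=
    (isCompact_subgroup H).isClosed.preimage (by fun_prop)
  convert isClosedMap_snd_of_compactSpace _ h using 1
  ext ⟨x, y⟩
  simp only [DoubleCoset.eq, Set.mem_ofPred_eq, Set.mem_image, Prod.exists, SetLike.mem_coe]
  constructor
  · rintro ⟨a, ha, b, hb, rfl⟩
    exact ⟨⟨a, ha⟩, x, _, by simpa [mul_assoc] using hb, rfl⟩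
  · rintro ⟨a, x, y, hb, ⟨⟩⟩
    exact ⟨a, a.2, _, hb, by group⟩

end DoubleCosetSpace

/-! ### The Markov kernel on G/H -/

section CosetKernel

open scoped ENNReal NNReal Pointwise Topology

variable {G : Type*} [Group G] [TopologicalSpace G] [IsTopologicalGroup G]
  [MeasurableSpace G] [BorelSpace G] (H : Subgroup G) [CompactSpace H]

/-- The normalized Haar measure of the compact group `H`, as a measure on `H`. -/
abbrev compactHaar : Measure H := Measure.haarMeasure (⊤ : PositiveCompacts H)

instance : IsProbabilityMeasure (compactHaar H) := ⟨by
  simpa using Measure.haarMeasure_self (K₀ := (⊤ : PositiveCompacts H))⟩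

instance : (compactHaar H).IsMulRightInvariant := ⟨fun a => by
  have : IsProbabilityMeasure ((compactHaar H).map (· * a)) :=
    Measure.isProbabilityMeasure_map (measurable_mul_const a).aemeasurable
  exact Measure.isHaarMeasure_eq_of_isProbabilityMeasure _ _⟩

instance : (compactHaar H).IsInvInvariant := ⟨by
  have : IsProbabilityMeasure (compactHaar H).inv :=
    Measure.isProbabilityMeasure_map measurable_inv.aemeasurable
  have : (compactHaar H).inv.IsOpenPosMeasure :=
    continuous_inv.isOpenPosMeasure_map inv_surjective
  have : (compactHaar H).inv.IsHaarMeasure := {}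
  exact Measure.isHaarMeasure_eq_of_isProbabilityMeasure _ _⟩

-- Two-sided invariance of the compact Haar measure; this absorbs every change of representatives
-- below.
variable {H} in
theorem map_compactHaar_mul_mul {Y : Type*} [MeasurableSpace Y] {f : H → Y} (hf : Measurable f)
    (b c : H) :
    (compactHaar H).map (fun a => f (b * a * c)) = (compactHaar H).map f := by
  have h1 : MeasurePreserving (fun a : H => b * a) (compactHaar H) (compactHaar H) :=
    measurePreserving_mul_left _ b
  have h2 : MeasurePreserving (fun a : H => a * c) (compactHaar H) (compactHaar H) :=
    measurePreserving_mul_right _ c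
  have h := (h2.comp h1)
  rw [← h.map_eq, Measure.map_map hf h.measurable, h.map_eq]
  rfl

variable [T2Space G]

theorem haarOfCompact_map {Y : Type*} [MeasurableSpace Y] {f : G → Y} (hf : Measurable f) :
    (haarOfCompact H).map f = (compactHaar H).map fun a : H => f a :=
  Measure.map_map hf measurable_subtype_coe

theorem lintegral_haarOfCompact {f : G → ℝ≥0∞} (hf : Measurable f) :
    ∫⁻ x, f x ∂(haarOfCompact H) = ∫⁻ a : H, f a ∂(compactHaar H) :=
  lintegral_map hf measurable_subtype_coe

theorem groupConv_dirac (x : G) (μ : Measure G) :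
    groupConv (Measure.dirac x) μ = μ.map fun y => x * y := by
  ext A hA
  rw [groupConv, Measure.bind_apply hA aemeasurable_dirac, lintegral_dirac]

theorem measurable_haarOfCompact_translate (y : G) :
    Measurable fun x => (haarOfCompact H).map fun a => x * (y * a) := by
  have : ∀ x, (haarOfCompact H).map (fun a => x * (y * a)) =
      (compactHaar H).map fun a : H => x * (y * a) := fun x =>
    haarOfCompact_map H (by fun_prop : Continuous fun a => x * (y * a)).measurable
  simp_rw [this]
  exact measurable_map_of_continuous _ (by fun_prop : Continuous fun p : G × H => p.1 * (y * p.2))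

variable [MeasurableSpace (G ⧸ H)] [BorelSpace (G ⧸ H)]

theorem measurable_cosetMk : Measurable ((↑) : G → G ⧸ H) :=
  QuotientGroup.continuous_mk.measurable

theorem continuous_cosetMk_mul (x h : G) : Continuous fun a : H => ((x * a * h : G) : G ⧸ H) :=
  QuotientGroup.continuous_mk.comp (by fun_prop)

/-- The kernel at `(x, h)` is the distribution of `xahH` for a random element `a` of `H`. -/
theorem cosetKernel_eq_map (x h : G) :
    cosetKernel H x h = (compactHaar H).map fun a : H => ((x * a * h : G) : G ⧸ H) := by
  have hm : ∀ y : G, Measurable fun z : G => y * z := fun y =>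
    (by fun_prop : Continuous fun z : G => y * z).measurable
  have hx : Measurable fun y : G => ((x * y : G) : G ⧸ H) :=
    (measurable_cosetMk H).comp (hm x)
  have e : ∀ y : G, ((haarOfCompact H).map fun z => h * z).map (fun z => y * z) =
      (haarOfCompact H).map fun a => y * (h * a) := fun y => Measure.map_map (hm y) (hm h)
  rw [cosetKernel, groupConv_dirac, groupConv_dirac, Measure.map_map (measurable_cosetMk H) (hm x),
    groupConv]
  simp_rw [e]
  ext A hA
  have hA' : MeasurableSet ((fun y : G => ((x * y : G) : G ⧸ H)) ⁻¹' A) := hx hA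
  have hmeas := measurable_haarOfCompact_translate H h
  have hmeas' : Measurable fun y => (haarOfCompact H).map (fun a => y * (h * a))
      ((fun y : G => ((x * y : G) : G ⧸ H)) ⁻¹' A) := (Measure.measurable_coe hA').comp hmeas
  change ((haarOfCompact H).bind _).map (fun y : G => ((x * y : G) : G ⧸ H)) A = _
  rw [Measure.map_apply hx hA, Measure.bind_apply hA' hmeas.aemeasurable,
    lintegral_haarOfCompact H hmeas',
    ← lintegral_indicator_one hA, lintegral_map (measurable_one.indicator hA)
      (continuous_cosetMk_mul H x h).measurable]
  refine lintegral_congr fun a => ?_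
  rw [haarOfCompact_map H (by fun_prop : Continuous fun b : G => (a : G) * (h * b)).measurable,
    Measure.map_apply (by fun_prop : Continuous fun b : H => (a : G) * (h * b)).measurable hA']
  -- The rightmost factor ω_H disappears in G/H, leaving a single average over `H`.
  have : ∀ b : H, ((x * (a * (h * b)) : G) : G ⧸ H) = ((x * a * h : G) : G ⧸ H) := fun b => by
    rw [QuotientGroup.eq]
    convert (b⁻¹).2 using 1
    simp [mul_assoc]
  simp only [Set.preimage, this, Set.mem_ofPred_eq, Set.indicator]
  split_ifs with ha <;> simp [ha]

/-- The transition measures of `G/H`, as a function on `G/H × G//H`. -/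
def cosetTransition (p : (G ⧸ H) × DoubleCosetSpace H) : Measure (G ⧸ H) :=
  (compactHaar H).map fun a : H => ((p.1.out * a * p.2.out : G) : G ⧸ H)

/-- Independence of the chosen representatives: x becomes xb and h becomes chd with b, c, d ∈ H.
Then `b` and `c` are absorbed by invariance, and `d` vanishes in the coset. -/
theorem cosetTransition_mk (x h : G) :
    cosetTransition H ((x : G ⧸ H), DoubleCoset.mk H H h) =
      (compactHaar H).map fun a : H => ((x * a * h : G) : G ⧸ H) := by
  obtain ⟨b, hb⟩ := QuotientGroup.mk_out_eq_mul H x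
  obtain ⟨c, d, hc, hd, hcd⟩ := DoubleCoset.mk_out_eq_mul H H h
  rw [cosetTransition,
    ← map_compactHaar_mul_mul (continuous_cosetMk_mul H x h).measurable b ⟨c, hc⟩]
  congr 1
  ext a
  rw [hb, hcd, QuotientGroup.eq]
  convert H.inv_mem hd using 1
  simp only [Subgroup.coe_mul]
  group

theorem continuous_uncurry_cosetMk : Continuous (Function.uncurry
    fun (p : G × G) (a : H) => ((p.1 * a * p.2 : G) : G ⧸ H)) :=
  QuotientGroup.continuous_mk.comp (by fun_prop)

/-- The σ-algebra is the Borel one of the product topology; without second countability it may be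
larger than the product σ-algebra. -/
theorem measurable_cosetTransition :
    Measurable[borel ((G ⧸ H) × DoubleCosetSpace H)] (cosetTransition H) := by
  let _ : MeasurableSpace ((G ⧸ H) × DoubleCosetSpace H) := borel _
  have : BorelSpace ((G ⧸ H) × DoubleCosetSpace H) := ⟨rfl⟩
  exact measurable_of_quotient (compactHaar H) (continuous_uncurry_cosetMk H)
    (isOpenQuotientMap_prod H) fun p => cosetTransition_mk H p.1 p.2

/-- The Markov kernel from `G/H × G//H` to `G/H`. -/
def cosetMarkovKernel :
    Kernel[borel ((G ⧸ H) × DoubleCosetSpace H)] ((G ⧸ H) × DoubleCosetSpace H) (G ⧸ H) :=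
  let _ := borel ((G ⧸ H) × DoubleCosetSpace H)
  ⟨cosetTransition H, measurable_cosetTransition H⟩

theorem cosetMarkovKernel_apply (p : (G ⧸ H) × DoubleCosetSpace H) :
    cosetMarkovKernel H p = cosetTransition H p := rfl

theorem isProbabilityMeasure_cosetTransition (p : (G ⧸ H) × DoubleCosetSpace H) :
    IsProbabilityMeasure (cosetTransition H p) :=
  Measure.isProbabilityMeasure_map (continuous_cosetMk_mul H _ _).measurable.aemeasurable

theorem isMarkovKernel_cosetMarkovKernel : IsMarkovKernel (cosetMarkovKernel H) := by
  let _ := borel ((G ⧸ H) × DoubleCosetSpace H)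
  exact ⟨isProbabilityMeasure_cosetTransition H⟩

end CosetKernel

/-! ### The double coset hypergroup -/

section DoubleCosetHypergroup

open scoped ENNReal NNReal Pointwise Topology

variable {G : Type*} [Group G] [TopologicalSpace G] [IsTopologicalGroup G] [T2Space G]
  [MeasurableSpace G] [BorelSpace G] (H : Subgroup G) [CompactSpace H]
  [MeasurableSpace (G ⧸ H)] [BorelSpace (G ⧸ H)]
  [MeasurableSpace (DoubleCosetSpace H)] [BorelSpace (DoubleCosetSpace H)]

/-- The measures `δ_c * δ_d` on `G//H`. -/
def doubleCosetTransition (p : DoubleCosetSpace H × DoubleCosetSpace H) :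
    Measure (DoubleCosetSpace H) :=
  (cosetTransition H ((p.1.out : G ⧸ H), p.2)).map (cosetToDoubleCoset H)

theorem continuous_doubleCosetMk_mul (x h : G) :
    Continuous fun a : H => DoubleCoset.mk H H (x * a * h) :=
  (continuous_doubleCosetMk H).comp (by fun_prop)

theorem doubleCosetTransition_mk (x y : G) :
    doubleCosetTransition H (DoubleCoset.mk H H x, DoubleCoset.mk H H y) =
      (compactHaar H).map fun a : H => DoubleCoset.mk H H (x * a * y) := by
  obtain ⟨c, d, hc, hd, hcd⟩ := DoubleCoset.mk_out_eq_mul H H x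
  rw [doubleCosetTransition, hcd, cosetTransition_mk, Measure.map_map
    (continuous_cosetToDoubleCoset H).measurable (continuous_cosetMk_mul H _ _).measurable,
    ← map_compactHaar_mul_mul (continuous_doubleCosetMk_mul H x y).measurable ⟨d, hd⟩ 1]
  congr 1
  ext a
  simp only [Function.comp, cosetToDoubleCoset_mk, Subgroup.coe_mul, mul_one]
  rw [← doubleCosetMk_mul_left H hc (x * _ * y)]
  simp only [mul_assoc]

theorem map_cosetTransition (x : G) (d : DoubleCosetSpace H) :
    (cosetTransition H ((x : G ⧸ H), d)).map (cosetToDoubleCoset H) =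
      doubleCosetTransition H (DoubleCoset.mk H H x, d) := by
  obtain ⟨y, rfl⟩ := surjective_doubleCosetMk H d
  rw [doubleCosetTransition_mk, cosetTransition_mk, Measure.map_map
    (continuous_cosetToDoubleCoset H).measurable (continuous_cosetMk_mul H _ _).measurable]
  rfl

theorem continuous_uncurry_doubleCosetMk : Continuous (Function.uncurry
    fun (p : G × G) (a : H) => DoubleCoset.mk H H (p.1 * a * p.2)) :=
  (continuous_doubleCosetMk H).comp (by fun_prop)

theorem isOpenQuotientMap_doubleCosetMk_prod : IsOpenQuotientMap
    (Prod.map (DoubleCoset.mk H H) (DoubleCoset.mk H H)) :=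
  (isOpenQuotientMap_doubleCosetMk H).prodMap (isOpenQuotientMap_doubleCosetMk H)

instance (p : DoubleCosetSpace H × DoubleCosetSpace H) :
    IsProbabilityMeasure (doubleCosetTransition H p) := by
  have := isProbabilityMeasure_cosetTransition H ((p.1.out : G ⧸ H), p.2)
  exact Measure.isProbabilityMeasure_map (continuous_cosetToDoubleCoset H).measurable.aemeasurable

variable [LocallyCompactSpace G] [SecondCountableTopology (G ⧸ H)]

instance : SecondCountableTopology (DoubleCosetSpace H) :=
  secondCountableTopology_doubleCosetSpace H

theorem measurable_doubleCosetTransition : Measurable (doubleCosetTransition H) :=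
  measurable_of_quotient (compactHaar H) (continuous_uncurry_doubleCosetMk H)
    (isOpenQuotientMap_doubleCosetMk_prod H) fun p => doubleCosetTransition_mk H p.1 p.2

/-- The kernel `(c, d) ↦ δ_c * δ_d` on `G//H`. -/
def doubleCosetKernel : Kernel (DoubleCosetSpace H × DoubleCosetSpace H) (DoubleCosetSpace H) :=
  ⟨doubleCosetTransition H, measurable_doubleCosetTransition H⟩

instance : IsMarkovKernel (doubleCosetKernel H) :=
  ⟨fun p => inferInstanceAs (IsProbabilityMeasure (doubleCosetTransition H p))⟩

theorem measurable_cosetTransition_prod : Measurable (cosetTransition H) :=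
  measurable_of_quotient (compactHaar H) (continuous_uncurry_cosetMk H)
    (isOpenQuotientMap_prod H) fun p => cosetTransition_mk H p.1 p.2

/-- The Chapman–Kolmogorov relation of the coset kernel. -/
theorem lintegral_cosetTransition_comp (c d : DoubleCosetSpace H) (x : G ⧸ H) {A : Set (G ⧸ H)}
    (hA : MeasurableSet A) :
    ∫⁻ y, cosetTransition H (y, d) A ∂(cosetTransition H (x, c)) =
      ∫⁻ h, cosetTransition H (x, h) A ∂(doubleCosetTransition H (c, d)) := by
  obtain ⟨x, rfl⟩ := QuotientGroup.mk_surjective x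
  obtain ⟨c, rfl⟩ := surjective_doubleCosetMk H c
  obtain ⟨d, rfl⟩ := surjective_doubleCosetMk H d
  have hK : Measurable fun p => cosetTransition H p A :=
    (Measure.measurable_coe hA).comp (measurable_cosetTransition_prod H)
  have h1 : ∀ (u v : G), cosetTransition H ((u : G ⧸ H), DoubleCoset.mk H H v) A =
      ∫⁻ a : H, A.indicator 1 ((u * a * v : G) : G ⧸ H) ∂(compactHaar H) := fun u v => by
    rw [cosetTransition_mk, ← lintegral_indicator_one hA, lintegral_map
      (measurable_one.indicator hA) (continuous_cosetMk_mul H u v).measurable]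
  have hK1 : Measurable fun y => cosetTransition H (y, DoubleCoset.mk H H d) A :=
    hK.comp measurable_prodMk_right
  have hK2 : Measurable fun h => cosetTransition H ((x : G ⧸ H), h) A :=
    hK.comp measurable_prodMk_left
  rw [cosetTransition_mk, doubleCosetTransition_mk,
    lintegral_map hK1 (continuous_cosetMk_mul H x c).measurable,
    lintegral_map hK2 (continuous_doubleCosetMk_mul H c d).measurable]
  simp_rw [h1]
  -- Joint measurability on H × H is not automatic from continuity, as `H` need not be second
  -- countable. The map factors through H × G/H, whose Borel and product σ-algebras agree.
  have hm : Measurable fun p : H × H => ((x * p.1 * c * p.2 * d : G) : G ⧸ H) := by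
    have e : Continuous fun p : H × (G ⧸ H) => (x * p.1 * c : G) • p.2 := by fun_prop
    have e' : Measurable fun p : H × H => (p.1, ((p.2 * d : G) : G ⧸ H)) :=
      measurable_fst.prodMk
        (((QuotientGroup.continuous_mk.comp (by fun_prop : Continuous fun b : H => (b * d : G)))
          ).measurable.comp measurable_snd)
    convert e.measurable.comp e' using 2 with p
    simp [mul_assoc]
  rw [lintegral_lintegral_swap
    (f := fun a b : H => A.indicator (1 : G ⧸ H → ℝ≥0∞) ((x * a * c * b * d : G) : G ⧸ H))
    ((measurable_one.indicator hA).comp hm).aemeasurable]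
  simp only [mul_assoc]

/-- Chapman–Kolmogorov applied to the preimage of `A` in G/H, because the coset kernel projects onto
the double coset kernel. -/
theorem doubleCosetKernel_assoc (x y z : DoubleCosetSpace H) (A : Set (DoubleCosetSpace H))
    (hA : MeasurableSet A) :
    ∫⁻ w, doubleCosetKernel H (w, z) A ∂(doubleCosetKernel H (x, y)) =
      ∫⁻ w, doubleCosetKernel H (x, w) A ∂(doubleCosetKernel H (y, z)) := by
  obtain ⟨x, rfl⟩ := surjective_doubleCosetMk H x
  have hr := (continuous_cosetToDoubleCoset H).measurable
  have h : ∀ (v : G ⧸ H) d, doubleCosetTransition H (cosetToDoubleCoset H v, d) A =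
      cosetTransition H (v, d) (cosetToDoubleCoset H ⁻¹' A) := fun v d => by
    obtain ⟨v, rfl⟩ := QuotientGroup.mk_surjective v
    rw [cosetToDoubleCoset_mk, ← map_cosetTransition, Measure.map_apply hr hA]
  have hm : Measurable fun w => doubleCosetKernel H (w, z) A :=
    ((doubleCosetKernel H).measurable_coe hA).comp measurable_prodMk_right
  have e : doubleCosetKernel H (DoubleCoset.mk H H x, y) =
      (cosetTransition H ((x : G ⧸ H), y)).map (cosetToDoubleCoset H) :=
    (map_cosetTransition H x y).symm
  rw [e, lintegral_map hm hr]
  change ∫⁻ v, doubleCosetTransition H (cosetToDoubleCoset H v, z) A ∂_ =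
    ∫⁻ w, doubleCosetTransition H (cosetToDoubleCoset H (x : G ⧸ H), w) A
      ∂(doubleCosetTransition H (y, z))
  simp_rw [h]
  exact lintegral_cosetTransition_comp H y z x (hr hA)

theorem continuous_integral_doubleCosetTransition {f : DoubleCosetSpace H → ℂ}
    (hf : Continuous f) : Continuous fun p => ∫ z, f z ∂(doubleCosetTransition H p) :=
  continuous_integral_of_quotient (compactHaar H) (continuous_uncurry_doubleCosetMk H)
    (isOpenQuotientMap_doubleCosetMk_prod H) (fun p => doubleCosetTransition_mk H p.1 p.2) hf

/-- The convolution of measures on `G//H`. -/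
def doubleCosetConvolution : MeasureConvolution (DoubleCosetSpace H) :=
  MeasureConvolution.ofKernel (doubleCosetKernel H) (doubleCosetKernel_assoc H) fun f =>
    continuous_integral_of_quotient (compactHaar H) (continuous_uncurry_doubleCosetMk H)
      (isOpenQuotientMap_doubleCosetMk_prod H) (fun p => doubleCosetTransition_mk H p.1 p.2)
      f.continuous

theorem ptConv_doubleCosetConvolution (c d : DoubleCosetSpace H) :
    (doubleCosetConvolution H).ptConv c d = doubleCosetTransition H (c, d) :=
  kernelConv_dirac (doubleCosetKernel H) c d

/-- The involution `HgH ↦ Hg⁻¹H`. -/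
def doubleCosetInv : DoubleCosetSpace H → DoubleCosetSpace H :=
  Quotient.lift (fun x : G => DoubleCoset.mk H H x⁻¹) fun x y hxy => by
    obtain ⟨a, ha, b, hb, rfl⟩ := DoubleCoset.rel_iff.1 hxy
    exact (DoubleCoset.eq H H _ _).2 ⟨b⁻¹, H.inv_mem hb, a⁻¹, H.inv_mem ha, by group⟩

theorem doubleCosetInv_mk (x : G) :
    doubleCosetInv H (DoubleCoset.mk H H x) = DoubleCoset.mk H H x⁻¹ := rfl

theorem continuous_doubleCosetInv : Continuous (doubleCosetInv H) :=
  (isQuotientMap_doubleCosetMk H).continuous_iff.2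
    ((continuous_doubleCosetMk H).comp continuous_inv)

/-- The double coset hypergroup `G//H`. -/
def doubleCosetHypergroup : Hypergroup (DoubleCosetSpace H) where
  toMeasureConvolution := doubleCosetConvolution H
  isProbabilityMeasure_ptConv x y := by
    rw [ptConv_doubleCosetConvolution]; infer_instance
  support_ptConv := by
    simp_rw [ptConv_doubleCosetConvolution]
    exact hasContinuousCompactSupport_of_quotient (compactHaar H)
      (continuous_uncurry_doubleCosetMk H) (isOpenQuotientMap_doubleCosetMk_prod H)
      fun p => doubleCosetTransition_mk H p.1 p.2
  e := DoubleCoset.mk H H 1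
  ptConv_e x := by
    obtain ⟨x, rfl⟩ := surjective_doubleCosetMk H x
    rw [ptConv_doubleCosetConvolution, doubleCosetTransition_mk]
    have : ∀ a : H, DoubleCoset.mk H H (x * a * 1) = DoubleCoset.mk H H x := fun a => by
      rw [mul_one, doubleCosetMk_mul_right H a.2]
    simp_rw [this, Measure.map_const, measure_univ, one_smul]
  e_ptConv x := by
    obtain ⟨x, rfl⟩ := surjective_doubleCosetMk H x
    rw [ptConv_doubleCosetConvolution, doubleCosetTransition_mk]
    have : ∀ a : H, DoubleCoset.mk H H (1 * a * x) = DoubleCoset.mk H H x := fun a => by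
      rw [one_mul, doubleCosetMk_mul_left H a.2]
    simp_rw [this, Measure.map_const, measure_univ, one_smul]
  inv := doubleCosetInv H
  continuous_inv := continuous_doubleCosetInv H
  inv_inv x := by
    obtain ⟨x, rfl⟩ := surjective_doubleCosetMk H x
    rw [doubleCosetInv_mk, doubleCosetInv_mk, inv_inv]
  e_mem_support_iff x y := by
    obtain ⟨x, rfl⟩ := surjective_doubleCosetMk H x
    obtain ⟨y, rfl⟩ := surjective_doubleCosetMk H y
    rw [ptConv_doubleCosetConvolution, doubleCosetTransition_mk, support_map_of_continuous _
      (continuous_doubleCosetMk_mul H x y), doubleCosetInv_mk, eq_comm (a := DoubleCoset.mk H H y),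
      DoubleCoset.eq]
    constructor
    · rintro ⟨a, ha⟩
      obtain ⟨b, hb, c, hc, h⟩ := (DoubleCoset.eq H H _ _).1 ha
      have h' : b * (x * a * y) * c = 1 := h.symm
      -- The witnesses come from y = a⁻¹ x⁻¹ (xay), where xay = b⁻¹c⁻¹ lies in `H`.
      refine ⟨(a : G)⁻¹, H.inv_mem a.2, b⁻¹ * c⁻¹, H.mul_mem (H.inv_mem hb) (H.inv_mem hc), ?_⟩
      have : x * a * y = b⁻¹ * c⁻¹ := by
        rw [← mul_right_inj b, mul_inv_cancel_left, ← mul_left_inj c, h', inv_mul_cancel]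
      rw [← this]; group
    · rintro ⟨a, ha, b, hb, rfl⟩
      refine ⟨⟨a⁻¹, H.inv_mem ha⟩, ?_⟩
      have : x * a⁻¹ * (a * x⁻¹ * b) = 1 * b := by group
      simp only [this]
      exact doubleCosetMk_mul_right H hb 1
  map_inv_ptConv x y := by
    obtain ⟨x, rfl⟩ := surjective_doubleCosetMk H x
    obtain ⟨y, rfl⟩ := surjective_doubleCosetMk H y
    -- The involution sends HxayH to Hy⁻¹a⁻¹x⁻¹H; inversion invariance of the Haar measure of `H`
    -- replaces a⁻¹ by `a`.
    rw [ptConv_doubleCosetConvolution, ptConv_doubleCosetConvolution, doubleCosetInv_mk,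
      doubleCosetInv_mk, doubleCosetTransition_mk, doubleCosetTransition_mk,
      Measure.map_map (continuous_doubleCosetInv H).measurable
        (continuous_doubleCosetMk_mul H x y).measurable,
      ← Measure.map_inv_eq_self (compactHaar H), Measure.map_map
        (continuous_doubleCosetMk_mul H _ _).measurable measurable_inv,
      Measure.map_inv_eq_self]
    congr 1
    ext a
    simp only [Function.comp, doubleCosetInv_mk, mul_inv_rev, Subgroup.coe_inv, mul_assoc]

theorem ptConv_doubleCosetHypergroup (c d : DoubleCosetSpace H) :
    (doubleCosetHypergroup H).ptConv c d = doubleCosetTransition H (c, d) :=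
  ptConv_doubleCosetConvolution H c d

end DoubleCosetHypergroup

/-! ### Compatibility with convolution of biinvariant measures on G -/

section Biinvariant

open scoped ENNReal NNReal Pointwise Topology

variable {G : Type*} [Group G] [TopologicalSpace G] [IsTopologicalGroup G] [T2Space G]
  [MeasurableSpace G] [BorelSpace G] (H : Subgroup G) [CompactSpace H]

/-- A biinvariant measure is invariant under left translation by elements of `H`. The convolution
with `ω_H` is zero by convention if its integrand is not measurable. -/
theorem IsBiinvariant.map_mul_left {H : Subgroup G} [CompactSpace H] {ν : Measure G}
    (hν : IsBiinvariant H ν) (b : H) : ν.map (fun y => (b : G) * y) = ν := by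
  have hmul : ∀ y : G, Measurable fun z : G => y * z := fun y =>
    (by fun_prop : Continuous fun z : G => y * z).measurable
  set ρ := groupConv ν (haarOfCompact H)
  have hν' : (haarOfCompact H).bind (fun x => ρ.map fun y => x * y) = ν := hν
  by_cases hm : AEMeasurable (fun x => ρ.map fun y => x * y) (haarOfCompact H)
  -- The change of variables along an embedding needs no measurability of the integrand, which here
  -- is only almost everywhere measurable.
  · have hemb : MeasurableEmbedding ((↑) : H → G) :=
      MeasurableEmbedding.subtype_coe (isCompact_subgroup H).isClosed.measurableSet
    have key : ∀ A, MeasurableSet A →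
        ν A = ∫⁻ a : H, ρ.map (fun y => (a : G) * y) A ∂(compactHaar H) := fun A hA => by
      conv_lhs => rw [← hν', Measure.bind_apply hA hm]
      exact hemb.lintegral_map _
    ext A hA
    rw [Measure.map_apply (hmul b) hA, key _ (hmul b hA), key A hA,
      ← lintegral_mul_left_eq_self (μ := compactHaar H)
        (fun a : H => ρ.map (fun y => (a : G) * y) A) b]
    refine lintegral_congr fun a => ?_
    rw [Measure.map_apply (hmul _) (hmul b hA), Measure.map_apply (hmul _) hA]
    simp only [Subgroup.coe_mul, mul_assoc, Set.preimage, Set.mem_ofPred_eq]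
  · rw [Measure.bind, Measure.map_of_not_aemeasurable hm, Measure.join_zero] at hν'
    rw [← hν', Measure.map_zero]

variable [MeasurableSpace (G ⧸ H)] [BorelSpace (G ⧸ H)]
  [MeasurableSpace (DoubleCosetSpace H)] [BorelSpace (DoubleCosetSpace H)]
  [LocallyCompactSpace G] [SecondCountableTopology (G ⧸ H)]

theorem isDoubleCosetHypergroup_doubleCosetHypergroup :
    IsDoubleCosetHypergroup H (doubleCosetHypergroup H) where
  e_eq := rfl
  inv_eq _ := rfl
  posConv_eq μ ν _ hνreg _ hν := by
    have hq := (continuous_doubleCosetMk H).measurable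
    ext A hA
    have hκ := (doubleCosetKernel H).measurable_coe hA
    -- Regularity of ν is used here: translates depend measurably on `x` by lower semicontinuity,
    -- without the product σ-algebra on G × G.
    have hR : Measurable fun x : G => (ν : Measure G).map fun y => x * y :=
      measurable_map_of_continuous (ν : Measure G)
        (by fun_prop : Continuous fun p : G × G => p.1 * p.2)
    change (kernelConv (doubleCosetKernel H) (μ.map _) (ν.map _) : Measure _) A = _
    rw [kernelConv_apply _ _ _ hA, FiniteMeasure.toMeasure_map, FiniteMeasure.toMeasure_map,
      lintegral_map (hκ.lintegral_prod_right' (ν := (ν : Measure G).map (DoubleCoset.mk H H))) hq,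
      Measure.map_apply hq hA, groupConv, Measure.bind_apply (hq hA) hR.aemeasurable]
    refine lintegral_congr fun x => ?_
    have hx : Measurable fun y : G => x * y := (by fun_prop : Continuous fun y => x * y).measurable
    have hind : Measurable (A.indicator (1 : DoubleCosetSpace H → ℝ≥0∞)) :=
      measurable_one.indicator hA
    have hκx : Measurable fun d => doubleCosetKernel H (DoubleCoset.mk H H x, d) A :=
      hκ.comp measurable_prodMk_left
    rw [lintegral_map hκx hq, ← lintegral_indicator_one (hq hA),
      lintegral_map (measurable_one.indicator (hq hA)) hx]
    have h1 : ∀ y : G, doubleCosetKernel H (DoubleCoset.mk H H x, DoubleCoset.mk H H y) A =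
        ∫⁻ a : H, A.indicator 1 (DoubleCoset.mk H H (x * a * y)) ∂(compactHaar H) := fun y => by
      change doubleCosetTransition H _ A = _
      rw [doubleCosetTransition_mk, ← lintegral_indicator_one hA,
        lintegral_map hind (continuous_doubleCosetMk_mul H x y).measurable]
    simp_rw [h1]
    have hm : Measurable fun p : G × H => DoubleCoset.mk H H (x * p.2 * p.1) := by
      have e : Continuous fun p : (G ⧸ H) × H => cosetToDoubleCoset H ((x * p.2 : G) • p.1) :=
        (continuous_cosetToDoubleCoset H).comp (by fun_prop)
      exact e.measurable.comp
        (((measurable_cosetMk H).comp measurable_fst).prodMk measurable_snd)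
    rw [lintegral_lintegral_swap
      (f := fun (y : G) (a : H) => A.indicator (1 : DoubleCosetSpace H → ℝ≥0∞)
        (DoubleCoset.mk H H (x * a * y))) (hind.comp hm).aemeasurable]
    -- Left invariance of ν under `H` absorbs `a`, so the average over `H` in the hypergroup
    -- convolution is trivial.
    have h2 : ∀ a : H, ∫⁻ y, A.indicator (1 : DoubleCosetSpace H → ℝ≥0∞)
        (DoubleCoset.mk H H (x * a * y)) ∂(ν : Measure G) =
        ∫⁻ y, A.indicator 1 (DoubleCoset.mk H H (x * y)) ∂(ν : Measure G) := fun a => by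
      conv_rhs => rw [← hν.map_mul_left a]
      have hx' : Measurable fun y => A.indicator (1 : DoubleCosetSpace H → ℝ≥0∞)
        (DoubleCoset.mk H H (x * y)) := (hind.comp hq).comp hx
      rw [lintegral_map hx'
        (by fun_prop : Continuous fun y : G => (a : G) * y).measurable]
      simp only [mul_assoc]
    simp_rw [h2]
    rw [lintegral_const, measure_univ, mul_one]
    rfl

end Biinvariant

/-! ### Invariant measures on G/H and G//H -/

section InvariantMeasures

open scoped ENNReal NNReal Pointwise Topology

theorem HasCompactSupport.comp_isProperMap {α β E : Type*} [TopologicalSpace α]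
    [TopologicalSpace β] [T2Space α] [Zero E] {f : β → E} (hf : HasCompactSupport f) {g : α → β}
    (hg : IsProperMap g) : HasCompactSupport (f ∘ g) :=
  HasCompactSupport.intro (hg.isCompact_preimage hf) fun _ hx =>
    image_eq_zero_of_notMem_tsupport (f := f) hx

theorem IsProperMap.regular_map {α β : Type*} [TopologicalSpace α] [MeasurableSpace α]
    [BorelSpace α] [TopologicalSpace β] [MeasurableSpace β] [BorelSpace β] [T2Space β]
    [LocallyCompactSpace β] [SecondCountableTopology β] {g : α → β} (hg : IsProperMap g)
    (μ : Measure α) [IsFiniteMeasureOnCompacts μ] : (μ.map g).Regular := by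
  have : IsFiniteMeasureOnCompacts (μ.map g) := ⟨fun K hK => by
    rw [Measure.map_apply hg.continuous.measurable hK.measurableSet]
    exact (hg.isCompact_preimage hK).measure_lt_top⟩
  infer_instance

variable {G : Type*} [Group G] [TopologicalSpace G] [IsTopologicalGroup G] [T2Space G]
  [LocallyCompactSpace G] [MeasurableSpace G] [BorelSpace G]
  (H : Subgroup G) [CompactSpace H]

/-- Averaging over two-sided translations does not change a Haar integral. -/
theorem integral_haar_translate {μ : Measure G} [μ.IsHaarMeasure] [μ.IsMulRightInvariant]
    {Φ : G → ℂ} (hΦ : Continuous Φ) (hΦc : HasCompactSupport Φ) {u v : H → G}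
    (hu : Continuous u) (hv : Continuous v) :
    ∫ y, ∫ a, Φ (u a * y * v a) ∂(compactHaar H) ∂μ = ∫ y, Φ y ∂μ := by
  rw [integral_integral_swap_of_hasCompactSupport (f := fun y a => Φ (u a * y * v a))
    (hΦ.comp (by fun_prop))]
  · have : ∀ a, ∫ y, Φ (u a * y * v a) ∂μ = ∫ y, Φ y ∂μ := fun a => by
      rw [integral_mul_left_eq_self (fun y => Φ (y * v a)) (u a),
        integral_mul_right_eq_self Φ (v a)]
    simp_rw [this, integral_const, probReal_univ, one_smul]
  -- The support lies in the image of tsupport Φ × H under the inverse substitution, which is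
  -- compact.
  · refine HasCompactSupport.intro (K := (fun p : G × H => ((u p.2)⁻¹ * p.1 * (v p.2)⁻¹, p.2)) ''
      (tsupport Φ ×ˢ Set.univ)) ((hΦc.isCompact.prod isCompact_univ).image (by fun_prop)) ?_
    rintro ⟨y, a⟩ h
    refine image_eq_zero_of_notMem_tsupport (f := Φ) fun h' =>
      h ⟨(u a * y * v a, a), ⟨h', trivial⟩, ?_⟩
    simp [mul_assoc]

variable [MeasurableSpace (G ⧸ H)] [BorelSpace (G ⧸ H)]
  [MeasurableSpace (DoubleCosetSpace H)] [BorelSpace (DoubleCosetSpace H)]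
  [SecondCountableTopology (G ⧸ H)]

/-- The invariant measure on `G/H`. -/
def cosetHaar : Measure (G ⧸ H) := (Measure.haar : Measure G).map ((↑) : G → G ⧸ H)

/-- The Haar measure on `G//H`. -/
def doubleCosetHaar : Measure (DoubleCosetSpace H) :=
  (Measure.haar : Measure G).map (DoubleCoset.mk H H)

theorem regular_cosetHaar : (cosetHaar H).Regular := (isProperMap_cosetMk H).regular_map _

theorem regular_doubleCosetHaar : (doubleCosetHaar H).Regular :=
  (isProperMap_doubleCosetMk H).regular_map _

theorem doubleCosetHaar_ne_zero : doubleCosetHaar H ≠ 0 := by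
  rw [doubleCosetHaar, Ne, Measure.map_eq_zero_iff
    (continuous_doubleCosetMk H).measurable.aemeasurable]
  exact NeZero.ne _

theorem integral_cosetHaar {f : G ⧸ H → ℂ} (hf : Continuous f) :
    ∫ x, f x ∂(cosetHaar H) = ∫ x : G, f x ∂(Measure.haar : Measure G) :=
  integral_map (measurable_cosetMk H).aemeasurable hf.aestronglyMeasurable

theorem integral_doubleCosetHaar {f : DoubleCosetSpace H → ℂ} (hf : Continuous f) :
    ∫ x, f x ∂(doubleCosetHaar H) =
      ∫ x : G, f (DoubleCoset.mk H H x) ∂(Measure.haar : Measure G) :=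
  integral_map (continuous_doubleCosetMk H).measurable.aemeasurable hf.aestronglyMeasurable

theorem integral_cosetTransition {f : G ⧸ H → ℂ} (hf : Continuous f) (x h : G) :
    ∫ y, f y ∂(cosetTransition H ((x : G ⧸ H), DoubleCoset.mk H H h)) =
      ∫ a : H, f ((x * a * h : G) : G ⧸ H) ∂(compactHaar H) := by
  rw [cosetTransition_mk]
  exact integral_map (continuous_cosetMk_mul H x h).measurable.aemeasurable
    hf.aestronglyMeasurable

theorem integral_doubleCosetTransition {f : DoubleCosetSpace H → ℂ} (hf : Continuous f) (x y : G) :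
    ∫ z, f z ∂(doubleCosetTransition H (DoubleCoset.mk H H x, DoubleCoset.mk H H y)) =
      ∫ a : H, f (DoubleCoset.mk H H (x * a * y)) ∂(compactHaar H) := by
  rw [doubleCosetTransition_mk]
  exact integral_map (continuous_doubleCosetMk_mul H x y).measurable.aemeasurable
    hf.aestronglyMeasurable

theorem continuous_integral_cosetTransition {f : G ⧸ H → ℂ} (hf : Continuous f) :
    Continuous fun p => ∫ y, f y ∂(cosetTransition H p) :=
  continuous_integral_of_quotient (compactHaar H) (continuous_uncurry_cosetMk H)
    (isOpenQuotientMap_prod H) (fun p => cosetTransition_mk H p.1 p.2) hf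

theorem isLeftHaar_doubleCosetHaar (hG : (Measure.haar : Measure G).IsMulRightInvariant) :
    (doubleCosetHypergroup H).IsLeftHaar (doubleCosetHaar H) where
  regular := regular_doubleCosetHaar H
  ne_zero := doubleCosetHaar_ne_zero H
  invariant f hf hfc x := by
    obtain ⟨x, rfl⟩ := surjective_doubleCosetMk H x
    simp_rw [ptConv_doubleCosetHypergroup]
    have hc : Continuous fun y =>
        ∫ z, f z ∂(doubleCosetTransition H (DoubleCoset.mk H H x, y)) :=
      (continuous_integral_doubleCosetTransition H hf).comp (Continuous.prodMk_right _)
    rw [integral_doubleCosetHaar H hf, integral_doubleCosetHaar H hc]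
    simp_rw [integral_doubleCosetTransition H hf]
    simpa using integral_haar_translate H (μ := Measure.haar)
      (hf.comp (continuous_doubleCosetMk H))
      (hfc.comp_isProperMap (isProperMap_doubleCosetMk H))
      (u := fun a => x * a) (v := fun _ => 1) (by fun_prop) (by fun_prop)

theorem isRightHaar_doubleCosetHaar (hG : (Measure.haar : Measure G).IsMulRightInvariant) :
    (doubleCosetHypergroup H).IsRightHaar (doubleCosetHaar H) where
  regular := regular_doubleCosetHaar H
  ne_zero := doubleCosetHaar_ne_zero H
  invariant f hf hfc x := by
    obtain ⟨x, rfl⟩ := surjective_doubleCosetMk H x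
    simp_rw [ptConv_doubleCosetHypergroup]
    have hc : Continuous fun y =>
        ∫ z, f z ∂(doubleCosetTransition H (y, DoubleCoset.mk H H x)) :=
      (continuous_integral_doubleCosetTransition H hf).comp (Continuous.prodMk_left _)
    rw [integral_doubleCosetHaar H hf, integral_doubleCosetHaar H hc]
    simp_rw [integral_doubleCosetTransition H hf]
    simpa [mul_assoc] using integral_haar_translate H (μ := Measure.haar)
      (hf.comp (continuous_doubleCosetMk H))
      (hfc.comp_isProperMap (isProperMap_doubleCosetMk H))
      (u := fun _ => 1) (v := fun a => a * x) (by fun_prop) (by fun_prop)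

theorem isAdjointMeasure_cosetHaar (hG : (Measure.haar : Measure G).IsMulRightInvariant) :
    IsAdjointMeasure (cosetTransition H) (doubleCosetInv H) (cosetHaar H) where
  regular := regular_cosetHaar H
  support_eq := by
    have : (cosetHaar H).IsOpenPosMeasure :=
      QuotientGroup.continuous_mk.isOpenPosMeasure_map QuotientGroup.mk_surjective
    exact Measure.support_eq_univ
  adjoint h f g hf hfc hg hgc := by
    obtain ⟨h, rfl⟩ := surjective_doubleCosetMk H h
    have hcK : ∀ {f : G ⧸ H → ℂ}, Continuous f → ∀ d,
        Continuous fun x => ∫ y, f y ∂(cosetTransition H (x, d)) := fun hf d =>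
      (continuous_integral_cosetTransition H hf).comp (Continuous.prodMk_left _)
    have hc1 : Continuous fun x => (∫ y, f y ∂(cosetTransition H
        (x, doubleCosetInv H (DoubleCoset.mk H H h)))) * g x := (hcK hf _).mul hg
    have hc2 : Continuous fun x => f x * ∫ y, g y ∂(cosetTransition H
        (x, DoubleCoset.mk H H h)) := hf.mul (hcK hg _)
    rw [integral_cosetHaar H hc1, integral_cosetHaar H hc2]
    simp_rw [doubleCosetInv_mk, integral_cosetTransition H hf, integral_cosetTransition H hg]
    have hπ : Continuous ((↑) : G → G ⧸ H) := QuotientGroup.continuous_mk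
    have hmk : ∀ (x : G) (a : H), ((x * a : G) : G ⧸ H) = x := fun x a =>
      QuotientGroup.mk_mul_of_mem x a.2
    -- Both sides of the adjoint relation equal ∫ Φ: averaging over y ↦ yah⁻¹ gives f(yah⁻¹H) g(yH),
    -- and averaging over y ↦ ya gives f(yH) g(yahH).
    set Φ : G → ℂ := fun y => f y * g ((y * h : G) : G ⧸ H) with hΦdef
    have hΦ : Continuous Φ := (hf.comp hπ).mul (hg.comp (hπ.comp (by fun_prop)))
    have hΦc : HasCompactSupport Φ := (hfc.comp_isProperMap (isProperMap_cosetMk H)).mul_right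
    have h1 := integral_haar_translate H (μ := Measure.haar) hΦ hΦc
      (u := fun _ => 1) (v := fun a => a * h⁻¹) (by fun_prop) (by fun_prop)
    have h2 := integral_haar_translate H (μ := Measure.haar) hΦ hΦc
      (u := fun _ => 1) (v := fun a => a) (by fun_prop) (by fun_prop)
    have e1 : ∀ (x : G) (a : H),
        Φ (1 * x * (a * h⁻¹)) = f ((x * a * h⁻¹ : G) : G ⧸ H) * g x := fun x a => by
      have : x * (a * h⁻¹) * h = x * a := by group
      simp only [hΦdef, one_mul, this, hmk, mul_assoc x]
    have e2 : ∀ (x : G) (a : H),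
        Φ (1 * x * a) = f x * g ((x * a * h : G) : G ⧸ H) := fun x a => by
      simp only [hΦdef, one_mul, hmk]
    simp_rw [e1, integral_mul_const] at h1
    simp_rw [e2, integral_const_mul] at h2
    exact h1.trans h2.symm

end InvariantMeasures

/-! ### The scheme on G/H and its translation properties -/

section Scheme

open scoped ENNReal NNReal Pointwise Topology

variable {G : Type*} [Group G] [TopologicalSpace G] [IsTopologicalGroup G] [T2Space G]
  [LocallyCompactSpace G] [MeasurableSpace G] [BorelSpace G]
  (H : Subgroup G) [CompactSpace H]

/-- The map `(xH, yH) ↦ Hx⁻¹yH`. -/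
def cosetProj (x y : G ⧸ H) : DoubleCosetSpace H :=
  Quotient.liftOn₂' x y (fun x y => DoubleCoset.mk H H (x⁻¹ * y)) fun x y x' y' hx hy => by
    rw [QuotientGroup.leftRel_apply] at hx hy
    refine (DoubleCoset.eq H H _ _).2 ⟨(x⁻¹ * x')⁻¹, H.inv_mem hx, y⁻¹ * y', hy, by group⟩

theorem cosetProj_mk (x y : G) :
    cosetProj H (x : G ⧸ H) (y : G ⧸ H) = DoubleCoset.mk H H (x⁻¹ * y) := rfl

theorem continuous_cosetProj : Continuous fun p : (G ⧸ H) × (G ⧸ H) => cosetProj H p.1 p.2 :=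
  ((QuotientGroup.isOpenQuotientMap_mk (N := H)).prodMap
    (QuotientGroup.isOpenQuotientMap_mk (N := H))).isQuotientMap.continuous_iff.2
    ((continuous_doubleCosetMk H).comp (by fun_prop : Continuous fun p : G × G => p.1⁻¹ * p.2))

variable [MeasurableSpace (G ⧸ H)] [BorelSpace (G ⧸ H)]

theorem mem_support_cosetTransition_iff (x y : G ⧸ H) (d : DoubleCosetSpace H) :
    y ∈ (cosetTransition H (x, d)).support ↔ d = cosetProj H x y := by
  obtain ⟨x, rfl⟩ := QuotientGroup.mk_surjective x
  obtain ⟨y, rfl⟩ := QuotientGroup.mk_surjective y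
  obtain ⟨d, rfl⟩ := surjective_doubleCosetMk H d
  rw [cosetTransition_mk, support_map_of_continuous _ (continuous_cosetMk_mul H x d), cosetProj_mk,
    DoubleCoset.eq]
  simp only [Set.mem_range, QuotientGroup.eq]
  constructor
  · rintro ⟨a, ha⟩
    exact ⟨a, a.2, _, ha, by group⟩
  · rintro ⟨a, ha, b, hb, h⟩
    refine ⟨⟨a, ha⟩, ?_⟩
    rw [inv_mul_eq_iff_eq_mul] at h
    convert hb using 1
    rw [h]; group

variable [MeasurableSpace (DoubleCosetSpace H)] [BorelSpace (DoubleCosetSpace H)]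
  [SecondCountableTopology (G ⧸ H)]

/-- The continuous association scheme `(G/H, G//H)` of a unimodular group. -/
def cosetScheme (hG : (Measure.haar : Measure G).IsMulRightInvariant) :
    CAS (G ⧸ H) (DoubleCosetSpace H) where
  t2Space := inferInstance
  locallyCompactSpace := inferInstance
  secondCountable := inferInstance
  K := cosetMarkovKernel H
  isMarkovKernel := isMarkovKernel_cosetMarkovKernel H
  continuous_K f := continuous_integral_cosetTransition H f.continuous
  support_K := hasContinuousCompactSupport_of_quotient (compactHaar H)
    (continuous_uncurry_cosetMk H) (isOpenQuotientMap_prod H)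
    fun p => cosetTransition_mk H p.1 p.2
  support_nonempty x d := by
    have := isProbabilityMeasure_cosetTransition H (x, d)
    exact Measure.nonempty_support (IsProbabilityMeasure.ne_zero (cosetTransition H (x, d)))
  partition x y := ⟨cosetProj H x y, (mem_support_cosetTransition_iff H x y _).2 rfl,
    fun d hd => (mem_support_cosetTransition_iff H x y d).1 hd⟩
  proj := cosetProj H
  mem_support_proj x y := (mem_support_cosetTransition_iff H x y _).2 rfl
  continuous_proj := continuous_cosetProj H
  hyp := doubleCosetHypergroup H
  comp_eq c d x A hA := by
    rw [ptConv_doubleCosetHypergroup]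
    exact lintegral_cosetTransition_comp H c d x hA
  K_e x := by
    obtain ⟨x, rfl⟩ := QuotientGroup.mk_surjective x
    change cosetTransition H ((x : G ⧸ H), DoubleCoset.mk H H 1) = _
    rw [cosetTransition_mk]
    have : ∀ a : H, ((x * a * 1 : G) : G ⧸ H) = x := fun a => by
      rw [mul_one]; exact QuotientGroup.mk_mul_of_mem x a.2
    simp_rw [this, Measure.map_const, measure_univ, one_smul]
  exists_adjointMeasure := ⟨cosetHaar H, isAdjointMeasure_cosetHaar H hG⟩

theorem isUnimodular_cosetScheme (hG : (Measure.haar : Measure G).IsMulRightInvariant) :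
    (cosetScheme H hG).IsUnimodular :=
  ⟨doubleCosetHaar H, isLeftHaar_doubleCosetHaar H hG, isRightHaar_doubleCosetHaar H hG⟩

theorem hasT1_cosetScheme (hG : (Measure.haar : Measure G).IsMulRightInvariant) :
    (cosetScheme H hG).HasT1 := fun d x f hf _ y => by
  change ∫ l, f l ∂((doubleCosetHypergroup H).ptConv (cosetProj H x y) d) =
    ∫ z, f (cosetProj H x z) ∂(cosetTransition H (y, d))
  obtain ⟨x, rfl⟩ := QuotientGroup.mk_surjective x
  obtain ⟨y, rfl⟩ := QuotientGroup.mk_surjective y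
  obtain ⟨d, rfl⟩ := surjective_doubleCosetMk H d
  have hfx : Continuous fun z => f (cosetProj H (x : G ⧸ H) z) :=
    hf.comp ((continuous_cosetProj H).comp (Continuous.prodMk_right _))
  rw [ptConv_doubleCosetHypergroup, cosetProj_mk, integral_doubleCosetTransition H hf,
    integral_cosetTransition H hfx]
  simp only [cosetProj_mk, mul_assoc]

theorem hasT2_cosetScheme (hG : (Measure.haar : Measure G).IsMulRightInvariant) :
    (cosetScheme H hG).HasT2 := by
  refine ⟨cosetHaar H, doubleCosetHaar H, isAdjointMeasure_cosetHaar H hG,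
    isLeftHaar_doubleCosetHaar H hG, fun f hf hfc g hg hgc x => ?_⟩
  change ∫ h, (∫ y, g y ∂(cosetTransition H (x, h))) * f h ∂(doubleCosetHaar H) =
    ∫ y, f (cosetProj H x y) * g y ∂(cosetHaar H)
  obtain ⟨x, rfl⟩ := QuotientGroup.mk_surjective x
  have hfx : Continuous fun y => f (cosetProj H (x : G ⧸ H) y) :=
    hf.comp ((continuous_cosetProj H).comp (Continuous.prodMk_right _))
  have hc1 : Continuous fun h => (∫ y, g y ∂(cosetTransition H ((x : G ⧸ H), h))) * f h :=
    ((continuous_integral_cosetTransition H hg).comp (Continuous.prodMk_right _)).mul hf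
  have hc2 : Continuous fun y => f (cosetProj H (x : G ⧸ H) y) * g y := hfx.mul hg
  rw [integral_doubleCosetHaar H hc1, integral_cosetHaar H hc2]
  simp_rw [integral_cosetTransition H hg, cosetProj_mk]
  have hπ : Continuous ((↑) : G → G ⧸ H) := QuotientGroup.continuous_mk
  -- Substituting y = xah in the right-hand integrand turns Hx⁻¹yH into HhH, independent of `a`; the
  -- remaining average of g(xahH) over `a` is T_h g(xH).
  have h := integral_haar_translate H (μ := Measure.haar)
    (hc2.comp hπ) ((hgc.mul_left).comp_isProperMap (isProperMap_cosetMk H))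
    (u := fun a => x * a) (v := fun _ => 1) (by fun_prop) (by fun_prop)
  refine Eq.trans ?_ h
  refine integral_congr_ae (.of_forall fun h => ?_)
  have e : ∀ a : H, DoubleCoset.mk H H (x⁻¹ * (x * a * h)) = DoubleCoset.mk H H h := fun a => by
    rw [← doubleCosetMk_mul_left H a.2 h]
    congr 1
    group
  simp only [Function.comp, mul_one, cosetProj_mk, e, integral_const_mul]
  exact mul_comm _ _

end Scheme

end

theorem proposition4p4 {G : Type*} [Group G] [TopologicalSpace G] [IsTopologicalGroup G]
    [T2Space G] [LocallyCompactSpace G] [MeasurableSpace G] [BorelSpace G]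
    (hG : (Measure.haar : Measure G).IsMulRightInvariant)
    (H : Subgroup G) [CompactSpace H]
    [MeasurableSpace (G ⧸ H)] [BorelSpace (G ⧸ H)]
    [MeasurableSpace (DoubleCoset.Quotient (H : Set G) (H : Set G))]
    [BorelSpace (DoubleCoset.Quotient (H : Set G) (H : Set G))] :
    (LocallyCompactSpace (G ⧸ H) ∧ T2Space (G ⧸ H) ∧
      LocallyCompactSpace (DoubleCoset.Quotient (H : Set G) (H : Set G)) ∧
      T2Space (DoubleCoset.Quotient (H : Set G) (H : Set G))) ∧
    (Continuous ((↑) : G → G ⧸ H) ∧ IsOpenMap ((↑) : G → G ⧸ H) ∧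
      IsClosedMap ((↑) : G → G ⧸ H)) ∧
    (Continuous (cosetToDoubleCoset H) ∧ IsOpenMap (cosetToDoubleCoset H) ∧
      IsClosedMap (cosetToDoubleCoset H)) ∧
    ∃ K : Kernel[borel ((G ⧸ H) × DoubleCoset.Quotient (H : Set G) (H : Set G))]
        ((G ⧸ H) × DoubleCoset.Quotient (H : Set G) (H : Set G)) (G ⧸ H),
      IsMarkovKernel K ∧
      (∀ x h : G, K ((x : G ⧸ H), DoubleCoset.mk H H h) = cosetKernel H x h) ∧
      (SecondCountableTopology (G ⧸ H) →
        ∃ C : CAS (G ⧸ H) (DoubleCoset.Quotient (H : Set G) (H : Set G)),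
          C.K = K ∧ IsDoubleCosetHypergroup H C.hyp ∧ C.IsUnimodular ∧ C.IsStrong) := by
  refine ⟨⟨inferInstance, inferInstance, inferInstanceAs (LocallyCompactSpace (DoubleCosetSpace H)),
      inferInstanceAs (T2Space (DoubleCosetSpace H))⟩,
    ⟨QuotientGroup.continuous_mk, QuotientGroup.isOpenMap_coe, isClosedMap_cosetMk H⟩,
    ⟨continuous_cosetToDoubleCoset H, isOpenMap_cosetToDoubleCoset H,
      isClosedMap_cosetToDoubleCoset H⟩,
    cosetMarkovKernel H, isMarkovKernel_cosetMarkovKernel H, fun x h => ?_, fun _ => ?_⟩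
  · rw [cosetMarkovKernel_apply, cosetTransition_mk, cosetKernel_eq_map]
  · exact ⟨cosetScheme H hG, rfl, isDoubleCosetHypergroup_doubleCosetHypergroup H,
      isUnimodular_cosetScheme H hG, hasT1_cosetScheme H hG, hasT2_cosetScheme H hG⟩
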